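/- **Theorem (LoRA excess risk, overdetermined regime).** There is an absolute constant $C>0$ with the following property. *Setting.* Let $n\ge d_x>r\ge 0$ and $d_y$ be integers. Let $x\in\mathbb{R}^{d_x}$ be a random vector with finite second moment and covariance $\Sigma_{xx}:=\mathbb{E}[xx^\top]$ of full rank. Let $\varepsilon\sim\mathcal N(0,\Sigma_{\varepsilon\varepsilon})$ be Gaussian noise in $\mathbb{R}^{d_y}$, independent of $x$, where $\Sigma_{\varepsilon\varepsilon}$ is any positive semidefinite matrix. For a fixed $A^\star\in\mathbb{R}^{d_y\times d_x}$ let $y=A^\star x+\varepsilon$. Let $A_0\in\mathbb{R}^{d_y\times d_x}$ be a fixed (pre-trained) matrix and $\Delta^\star:=A^\star-A_0$. Let $(x_1,y_1),\dots,(x_n,y_n)$ be i.i.d. copies of $(x,y)$, put $X=[x_1,\dots,x_n]$, $Y=[y_1,\dots,y_n]$, $\widehat\Sigma_{xx}:=\frac1n XX^\top$, and assume that $\widehat\Sigma_{xx}$ is invertible with probability one. The population risk of $A\in\mathbb{R}^{d_y\times d_x}$ is $\mathcal R(A):=\mathbb{E}\,\|Ax-y\|^2$. *Estimator.* Let $\widehat\Delta_{\mathrm{FFT}}:=(Y-A_0X)X^\dagger$,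 with $\dagger$ the Moore–Penrose inverse, and let $$\widehat A_{\mathrm{LoRA}}:=A_0+\big[\widehat\Delta_{\mathrm{FFT}}\,\widehat\Sigma_{xx}^{1/2}\big]_r\big(\widehat\Sigma_{xx}^{1/2}\big)^\dagger ,$$ where $[M]_r$ denotes a truncation of a singular value decomposition of $M$ to its $r$ largest singular values (if it is not unique, any choice is allowed). *Conclusion.* $\mathcal R(A^\star)<\infty$ and $$ \begin{aligned} \mathbb{E}\big[\mathcal R(\widehat A_{\mathrm{LoRA}})\big]-\mathcal R(A^\star)\le C\Big(&\frac{r\max\{d_x,d_y\}}{n}\,\lambda_{\max}(\Sigma_{\varepsilon\varepsilon})\,\mathbb{E}\big[\lambda_{\max}(\Sigma_{xx}\widehat\Sigma_{xx}^{-1})\big]\\ &+\lambda_{\max}(\Sigma_{xx})\Big(r\,\sigma_{r+1}^2(\Delta^\star)+\sum_{i=r+1}^{\min\{d_x,d_y\}}\sigma_i^2(\Delta^\star)\Big)\\ &+r\,\sigma_{r+1}^2(\Delta^\star)\,\mathbb{E}\big[\lambda_{\max}(\widehat\Sigma_{xx})\,\lambda_{\max}(\Sigma_{xx}\widehat\Sigma_{xx}^{-1})\big]\Big).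 \end{aligned} $$ Here $\sigma_1\ge\sigma_2\ge\cdots$ are singular values (with $\sigma_i=0$ for $i>\min\{d_x,d_y\}$), $\lambda_{\max}$ is the largest eigenvalue ($0$ for the empty matrix), and the outer expectations are over the training set and take values in $[0,\infty]$, with $0\cdot\infty=0$. -/

import Mathlib

open MeasureTheory ProbabilityTheory

open scoped ENNReal Matrix MatrixOrder

namespace LoRARegression

/-! ### Matrix notions -/

/-- The Moore–Penrose inverse of a real matrix, `X† = (Xᵀ X)† Xᵀ`. The Moore–Penrose inverse of the
symmetric matrix `Xᵀ X` inverts the nonzero eigenvalues and fixes the kernel; this is the functional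
calculus of `t ↦ t⁻¹` with `0⁻¹ = 0`. -/
noncomputable def pinv {m k : ℕ} (X : Matrix (Fin m) (Fin k) ℝ) : Matrix (Fin k) (Fin m) ℝ :=
  cfc (fun t : ℝ => t⁻¹) (Xᵀ * X) * Xᵀ

/-- The matrix `pinv X` satisfies the four Penrose conditions, which characterize it. -/
theorem pinv_spec {m k : ℕ} (X : Matrix (Fin m) (Fin k) ℝ) :
    X * pinv X * X = X ∧ pinv X * X * pinv X = pinv X ∧
      (X * pinv X)ᵀ = X * pinv X ∧ (pinv X * X)ᵀ = pinv X * X := by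
  set G : Matrix (Fin k) (Fin k) ℝ := Xᵀ * X with hG
  have hsa : IsSelfAdjoint G := by
    change Gᴴ = G
    simp [hG, Matrix.conjTranspose_eq_transpose_of_trivial]
  have hc : ∀ f : ℝ → ℝ, ContinuousOn f (spectrum ℝ G) := fun f =>
    Set.Finite.continuousOn (Matrix.finite_real_spectrum) f
  set P : Matrix (Fin k) (Fin k) ℝ := cfc (fun t : ℝ => t⁻¹) G with hP
  have hPX : pinv X = P * Xᵀ := rfl
  have hPs : Pᵀ = P := by
    have h : IsSelfAdjoint P := cfc_predicate _ G
    have h' : Pᴴ = P := h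
    rwa [Matrix.conjTranspose_eq_transpose_of_trivial] at h'
  have hGs : Gᵀ = G := by simp [hG]
  have hid : cfc (fun t : ℝ => t) G = G := cfc_id' ℝ G
  have hPG : P * G = cfc (fun t : ℝ => t⁻¹ * t) G := by
    rw [cfc_mul _ _ G (hc _) (hc _), hid]
  have hGP : G * P = cfc (fun t : ℝ => t⁻¹ * t) G := by
    have : (fun t : ℝ => t⁻¹ * t) = fun t : ℝ => t * t⁻¹ := by
      funext t; ring
    rw [this, cfc_mul _ _ G (hc _) (hc _), hid]
  have hcomm : G * P = P * G := by rw [hPG, hGP]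
  have hGPG : G * (P * G) = G := by
    rw [hPG]
    nth_rewrite 1 [← hid]
    rw [← cfc_mul _ _ G (hc _) (hc _)]
    nth_rewrite 2 [← hid]
    congr 1
    funext t
    by_cases ht : t = 0
    · simp [ht]
    · field_simp
  have hPGP : P * G * P = P := by
    rw [hPG, hP, ← cfc_mul _ _ G (hc _) (hc _)]
    congr 1
    funext t
    by_cases ht : t = 0
    · simp [ht]
    · field_simp
  have h1 : X * (P * G) = X := by
    rw [← sub_eq_zero, ← Matrix.conjTranspose_mul_self_eq_zero,
      Matrix.conjTranspose_eq_transpose_of_trivial]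
    have e : (X * (P * G) - X)ᵀ * (X * (P * G) - X)
        = (P * G)ᵀ * (G * (P * G)) - (P * G)ᵀ * G - G * (P * G) + G := by
      rw [Matrix.transpose_sub, Matrix.transpose_mul]
      simp only [hG, Matrix.sub_mul, Matrix.mul_sub, Matrix.mul_assoc]
      abel
    rw [e, hGPG]
    noncomm_ring
  refine ⟨?_, ?_, ?_, ?_⟩
  · rw [hPX, Matrix.mul_assoc, Matrix.mul_assoc, ← hG]
    exact h1
  · calc pinv X * X * pinv X = P * (Xᵀ * X) * P * Xᵀ := by
          rw [hPX]; simp only [Matrix.mul_assoc]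
      _ = pinv X := by rw [← hG, hPGP, hPX]
  · rw [hPX]
    simp [Matrix.transpose_mul, hPs, Matrix.mul_assoc]
  · rw [hPX, Matrix.mul_assoc, ← hG, Matrix.transpose_mul, hPs, hGs, hcomm]

/-- The largest (real) eigenvalue of a square matrix. -/
noncomputable def lambdaMax {k : ℕ} (A : Matrix (Fin k) (Fin k) ℝ) : ℝ :=
  sSup (spectrum ℝ A)

/-- The `i`-th largest singular value of a matrix, counted from `i = 1`. -/
noncomputable def sigma {m k : ℕ} (i : ℕ) (M : Matrix (Fin m) (Fin k) ℝ) : ℝ :=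
  (Matrix.toEuclideanLin M).singularValues (i - 1)

/-- `T` is a top-`r` singular value truncation of `M`: for some singular value decomposition
`M = ∑ i, s i • u i (v i)ᵀ` with `s` nonincreasing, `T` is the sum of the first `r` terms. -/
def IsTruncation {m k : ℕ} (r : ℕ) (M T : Matrix (Fin m) (Fin k) ℝ) : Prop :=
  ∃ (u : Fin (min m k) → EuclideanSpace ℝ (Fin m))
    (v : Fin (min m k) → EuclideanSpace ℝ (Fin k)) (s : Fin (min m k) → ℝ),
    Orthonormal ℝ u ∧ Orthonormal ℝ v ∧ Antitone s ∧ (∀ i, 0 ≤ s i) ∧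
    M = ∑ i, s i • Matrix.vecMulVec (u i).ofLp (v i).ofLp ∧
    T = ∑ i with i.val < r, s i • Matrix.vecMulVec (u i).ofLp (v i).ofLp

/-! ### The regression model -/

/-- The law of a sample `(x, y)` with `y = A x + ε`, where `x ∼ μ` and the noise
`ε ∼ N(0, S)` are independent. -/
noncomputable def sampleLaw {dx dy : ℕ} (μ : Measure (EuclideanSpace ℝ (Fin dx)))
    (A : Matrix (Fin dy) (Fin dx) ℝ) (S : Matrix (Fin dy) (Fin dy) ℝ) :
    Measure (EuclideanSpace ℝ (Fin dx) × EuclideanSpace ℝ (Fin dy)) :=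
  (μ.prod (multivariateGaussian 0 S)).map fun p => (p.1, Matrix.toEuclideanLin A p.1 + p.2)

/-- The population covariance `E[x xᵀ]` of the features. -/
noncomputable def popCov {dx : ℕ} (μ : Measure (EuclideanSpace ℝ (Fin dx))) :
    Matrix (Fin dx) (Fin dx) ℝ :=
  Matrix.of fun a b => ∫ x, x a * x b ∂μ

/-- The matrix whose columns are the vectors `z 1, …, z n`. -/
def dataMatrix {d n : ℕ} (z : Fin n → EuclideanSpace ℝ (Fin d)) : Matrix (Fin d) (Fin n) ℝ :=
  Matrix.of fun a i => z i a

/-- The empirical covariance `(1/n) X Xᵀ`. -/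
noncomputable def empCov {dx n : ℕ} (X : Matrix (Fin dx) (Fin n) ℝ) :
    Matrix (Fin dx) (Fin dx) ℝ :=
  (1 / (n : ℝ)) • (X * Xᵀ)

/-- The population risk `R(A) = E ‖A x - y‖²` for `(x, y) ∼ P`, with values in `[0, ∞]`. -/
noncomputable def risk {dx dy : ℕ}
    (P : Measure (EuclideanSpace ℝ (Fin dx) × EuclideanSpace ℝ (Fin dy)))
    (A : Matrix (Fin dy) (Fin dx) ℝ) : ℝ≥0∞ :=
  ∫⁻ p, ‖Matrix.toEuclideanLin A p.1 - p.2‖ₑ ^ 2 ∂P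

/-- The full fine-tuning update `(Y - A₀ X) X†`. -/
noncomputable def fftUpdate {dx dy n : ℕ} (A₀ : Matrix (Fin dy) (Fin dx) ℝ)
    (X : Matrix (Fin dx) (Fin n) ℝ) (Y : Matrix (Fin dy) (Fin n) ℝ) :
    Matrix (Fin dy) (Fin dx) ℝ :=
  (Y - A₀ * X) * pinv X

/-- `A` is a LoRA solution of rank `r` with pre-trained model `A₀` and data `X, Y`:
`A = A₀ + [D Ĉ^{1/2}]_r (Ĉ^{1/2})†`, with `D` the full fine-tuning update, `Ĉ` the empirical
covariance, and `[·]_r` a top-`r` singular value truncation. -/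
def IsLoRASolution {dx dy n : ℕ} (r : ℕ) (A₀ : Matrix (Fin dy) (Fin dx) ℝ)
    (X : Matrix (Fin dx) (Fin n) ℝ) (Y : Matrix (Fin dy) (Fin n) ℝ)
    (A : Matrix (Fin dy) (Fin dx) ℝ) : Prop :=
  ∃ T : Matrix (Fin dy) (Fin dx) ℝ,
    IsTruncation r (fftUpdate A₀ X Y * CFC.sqrt (empCov X)) T ∧
    A = A₀ + T * pinv (CFC.sqrt (empCov X))

end LoRARegression

/-! Since the noise is centred and independent of the features, the excess risk of `A` is the
quadratic form tr((A - A⋆) Σ (A - A⋆)ᵀ) (`risk_sampleLaw`). Everything else bounds this form, first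
deterministically and then in expectation.

Write H for the square root of the empirical covariance Ĉ, E for the noise matrix, and split Δ⋆ = D
+ R with D a best rank-r approximation, so that ‖R‖ ≤ σ_{r+1} and ‖R‖_F² is at most the tail sum
(`exists_rank_le_norm_sub_le`). When Ĉ is invertible, the matrix to be truncated is DH + (RH + N)
with N = E X† H. Its truncation T is as close to it in operator norm as any matrix of rank at most r
(`IsTruncation.norm_sub_le`), in particular as DH; hence K = T - DH has norm at most 2‖RH + N‖.
Moreover K has rank at most 2r, so ‖K‖_F² ≤ 2r‖K‖²: the price of rank is r and not the full
dimension. The error is KH⁻¹ - R, which gives `IsLoRASolution.trace_excess_le`, with the factor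
λmax(H⁻¹ΣH⁻¹) = λmax(ΣĈ⁻¹).

It remains to average ‖N‖². Given the features, N = EV with VᵀV = I/n, and E has independent
Gaussian columns. A net argument bounds the conditional mean of ‖EV‖² by a multiple of max(dx, dy)
λmax(S)/n (`lintegral_norm_dataMatrix_mul_sq_le`). As λmax(ΣĈ⁻¹) depends on the features only,
Tonelli's theorem pulls it out (`lintegral_noise_le`). -/

namespace LoRARegression

/-! ### Operator norms, spectra, rank and low-rank approximation. -/

section LinearAlgebra

open scoped Matrix.Norms.L2Operator

variable {m k l : ℕ}

theorem norm_toEuclideanLin_le (A : Matrix (Fin m) (Fin k) ℝ) (v : EuclideanSpace ℝ (Fin k)) :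
    ‖Matrix.toEuclideanLin A v‖ ≤ ‖A‖ * ‖v‖ :=
  Matrix.l2_opNorm_mulVec A v

theorem l2_opNorm_le_of_forall {A : Matrix (Fin m) (Fin k) ℝ} {c : ℝ} (hc : 0 ≤ c)
    (h : ∀ v : EuclideanSpace ℝ (Fin k), ‖Matrix.toEuclideanLin A v‖ ≤ c * ‖v‖) : ‖A‖ ≤ c := by
  rw [Matrix.l2_opNorm_def]
  exact ContinuousLinearMap.opNorm_le_bound _ hc h

theorem l2_opNorm_transpose (A : Matrix (Fin m) (Fin k) ℝ) : ‖Aᵀ‖ = ‖A‖ := by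
  rw [← Matrix.conjTranspose_eq_transpose_of_trivial, Matrix.l2_opNorm_conjTranspose]

theorem l2_opNorm_mul_transpose_self (A : Matrix (Fin m) (Fin k) ℝ) : ‖A * Aᵀ‖ = ‖A‖ ^ 2 := by
  have h := Matrix.l2_opNorm_conjTranspose_mul_self Aᵀ
  rw [Matrix.conjTranspose_eq_transpose_of_trivial, Matrix.transpose_transpose,
    l2_opNorm_transpose] at h
  rw [h, sq]

theorem l2_opNorm_transpose_mul_self (A : Matrix (Fin m) (Fin k) ℝ) : ‖Aᵀ * A‖ = ‖A‖ ^ 2 := by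
  have h := l2_opNorm_mul_transpose_self Aᵀ
  rwa [Matrix.transpose_transpose, l2_opNorm_transpose] at h

theorem norm_sq_toEuclideanLin (A : Matrix (Fin m) (Fin k) ℝ) (v : EuclideanSpace ℝ (Fin k)) :
    ‖Matrix.toEuclideanLin A v‖ ^ 2
      = inner ℝ (Matrix.toEuclideanLin (Aᵀ * A) v) v := by
  rw [← real_inner_self_eq_norm_sq, ← LinearMap.adjoint_inner_left,
    ← Matrix.toEuclideanLin_conjTranspose_eq_adjoint, Matrix.conjTranspose_eq_transpose_of_trivial]
  congr 1
  simp [Matrix.toLpLin_apply, Matrix.mulVec_mulVec]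

/-! ### The largest eigenvalue -/

theorem lambdaMax_smul_one_sub_posSemidef {A : Matrix (Fin k) (Fin k) ℝ} (hA : A.IsHermitian) :
    (lambdaMax A • (1 : Matrix (Fin k) (Fin k) ℝ) - A).PosSemidef := by
  rw [← Matrix.le_iff, ← Algebra.algebraMap_eq_smul_one]
  refine le_algebraMap_of_spectrum_le (fun x hx => ?_) hA
  exact le_csSup Matrix.finite_real_spectrum.bddAbove hx

theorem lambdaMax_nonneg {A : Matrix (Fin k) (Fin k) ℝ} (hA : A.PosSemidef) :
    0 ≤ lambdaMax A := by
  refine Real.sSup_nonneg fun x hx => ?_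
  rw [hA.1.spectrum_real_eq_range_eigenvalues] at hx
  obtain ⟨i, rfl⟩ := hx
  exact hA.eigenvalues_nonneg i

theorem inner_toEuclideanLin_le_lambdaMax {A : Matrix (Fin k) (Fin k) ℝ} (hA : A.IsHermitian)
    (v : EuclideanSpace ℝ (Fin k)) :
    inner ℝ (Matrix.toEuclideanLin A v) v ≤ lambdaMax A * ‖v‖ ^ 2 := by
  have h := (lambdaMax_smul_one_sub_posSemidef hA).dotProduct_mulVec_nonneg v.ofLp
  rw [EuclideanSpace.real_norm_sq_eq]
  simp only [star_trivial, Matrix.sub_mulVec, Matrix.smul_mulVec, Matrix.one_mulVec,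
    dotProduct_sub, dotProduct_smul, smul_eq_mul] at h
  have e : inner ℝ (Matrix.toEuclideanLin A v) v = v.ofLp ⬝ᵥ A *ᵥ v.ofLp := by
    simp [Matrix.toLpLin_apply, PiLp.inner_apply, dotProduct, Matrix.mulVec]
  have e' : v.ofLp ⬝ᵥ v.ofLp = ∑ i, v i ^ 2 := by
    simp [dotProduct, sq]
  rw [e, ← e']
  linarith

theorem l2_opNorm_sq_le_lambdaMax (A : Matrix (Fin m) (Fin k) ℝ) :
    ‖A‖ ^ 2 ≤ lambdaMax (Aᵀ * A) := by
  have hs : (Aᵀ * A).PosSemidef := by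
    simpa [Matrix.conjTranspose_eq_transpose_of_trivial] using
      Matrix.posSemidef_conjTranspose_mul_self A
  have h0 := lambdaMax_nonneg hs
  refine (Real.le_sqrt (norm_nonneg _) h0).1 ?_
  refine l2_opNorm_le_of_forall (Real.sqrt_nonneg _) fun v => ?_
  refine (sq_le_sq₀ (norm_nonneg _) (by positivity)).1 ?_
  rw [norm_sq_toEuclideanLin, mul_pow, Real.sq_sqrt h0]
  exact inner_toEuclideanLin_le_lambdaMax hs.1 v

theorem lambdaMax_le_norm (A : Matrix (Fin k) (Fin k) ℝ) : lambdaMax A ≤ ‖A‖ := by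
  rcases isEmpty_or_nonempty (Fin k) with h | h
  -- In the zero ring the spectrum is empty, and `sSup ∅ = 0`.
  · have : Subsingleton (Matrix (Fin k) (Fin k) ℝ) := inferInstance
    rw [lambdaMax, spectrum.of_subsingleton]
    simp
  · refine Real.sSup_le (fun x hx => ?_) (norm_nonneg _)
    have hN : NormOneClass (Matrix (Fin k) (Fin k) ℝ) := inferInstance
    exact (le_abs_self x).trans (spectrum.norm_le_norm_of_mem hx)

theorem lambdaMax_transpose_mul_self (A : Matrix (Fin m) (Fin k) ℝ) :
    lambdaMax (Aᵀ * A) = ‖A‖ ^ 2 :=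
  le_antisymm ((lambdaMax_le_norm _).trans_eq (l2_opNorm_transpose_mul_self A))
    (l2_opNorm_sq_le_lambdaMax A)

/-- Conjugating the positive semidefinite matrix λmax(Q)·1 - Q by `A` keeps its trace nonnegative.
-/
theorem trace_conj_le {Q : Matrix (Fin k) (Fin k) ℝ} (hQ : Q.IsHermitian)
    (A : Matrix (Fin m) (Fin k) ℝ) :
    (A * Q * Aᵀ).trace ≤ lambdaMax Q * (A * Aᵀ).trace := by
  have h := ((lambdaMax_smul_one_sub_posSemidef hQ).mul_mul_conjTranspose_same A).trace_nonneg
  rw [Matrix.conjTranspose_eq_transpose_of_trivial, Matrix.mul_sub, Matrix.sub_mul,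
    Matrix.trace_sub] at h
  simp only [Matrix.mul_smul, Matrix.mul_one, Matrix.smul_mul, Matrix.trace_smul,
    smul_eq_mul] at h
  linarith

/-! ### Rank -/

theorem rank_add_le (A B : Matrix (Fin m) (Fin k) ℝ) : (A + B).rank ≤ A.rank + B.rank := by
  rw [Matrix.rank, Matrix.rank, Matrix.rank, Matrix.mulVecLin_add]
  exact (Submodule.finrank_mono (LinearMap.range_add_le _ _)).trans
    (Submodule.finrank_add_le_finrank_add_finrank _ _)

theorem rank_neg (A : Matrix (Fin m) (Fin k) ℝ) : (-A).rank = A.rank := by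
  have : (-A).mulVecLin = -A.mulVecLin := by ext; simp
  rw [Matrix.rank, Matrix.rank, this, LinearMap.range_neg]

theorem rank_sum_vecMulVec_le {ι : Type*} (F : Finset ι) (c : ι → ℝ) (u : ι → Fin m → ℝ)
    (v : ι → Fin k → ℝ) :
    (∑ i ∈ F, c i • Matrix.vecMulVec (u i) (v i)).rank ≤ F.card := by
  classical
  induction F using Finset.induction_on with
  | empty => simp
  | insert a F ha ih =>
    rw [Finset.sum_insert ha, Finset.card_insert_of_notMem ha, add_comm F.card]
    refine (rank_add_le _ _).trans (add_le_add ?_ ih)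
    rw [← Matrix.smul_vecMulVec]
    exact Matrix.rank_vecMulVec_le _ _

/-- The trace is the sum of the nonzero eigenvalues of A Aᵀ; there are rank A of them, each at most
‖A‖². -/
theorem trace_mul_transpose_self_le (A : Matrix (Fin m) (Fin k) ℝ) :
    (A * Aᵀ).trace ≤ A.rank * ‖A‖ ^ 2 := by
  have hp : (A * Aᵀ).IsHermitian := by
    simpa [Matrix.conjTranspose_eq_transpose_of_trivial] using
      Matrix.isHermitian_mul_conjTranspose_self A
  have hle : ∀ i, hp.eigenvalues i ≤ ‖A‖ ^ 2 := fun i => by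
    rw [← l2_opNorm_mul_transpose_self]
    exact (le_csSup Matrix.finite_real_spectrum.bddAbove
      (hp.eigenvalues_mem_spectrum_real i)).trans (lambdaMax_le_norm _)
  rw [← Matrix.rank_self_mul_transpose, hp.rank_eq_card_non_zero_eigs, hp.trace_eq_sum_eigenvalues,
    Fintype.card_subtype, ← nsmul_eq_mul, ← Finset.sum_const, Finset.sum_filter]
  refine Finset.sum_le_sum fun i _ => ?_
  split_ifs with h
  · exact hle i
  · simp only [ne_eq, not_not] at h
    simp [h]

theorem exists_toEuclideanLin_linearCombination_eq_zero {r : ℕ} {B : Matrix (Fin m) (Fin k) ℝ}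
    (hB : B.rank ≤ r) (v : Fin (r + 1) → EuclideanSpace ℝ (Fin k)) :
    ∃ c : Fin (r + 1) → ℝ, c ≠ 0 ∧ Matrix.toEuclideanLin B (∑ i, c i • v i) = 0 := by
  let f : (Fin (r + 1) → ℝ) →ₗ[ℝ] EuclideanSpace ℝ (Fin k) := Fintype.linearCombination ℝ v
  let g := (Matrix.toEuclideanLin B).rangeRestrict ∘ₗ f
  have hr : Module.finrank ℝ (Matrix.toEuclideanLin B).range = B.rank := by
    rw [Matrix.rank_eq_finrank_range_toLin B (EuclideanSpace.basisFun _ ℝ).toBasis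
      (EuclideanSpace.basisFun _ ℝ).toBasis, Matrix.toEuclideanLin_eq_toLin_orthonormal]
  have hg : g.ker ≠ ⊥ := by
    apply LinearMap.ker_ne_bot_of_finrank_lt
    rw [hr]
    simp
    omega
  obtain ⟨c, hc, hc0⟩ := Submodule.exists_mem_ne_zero_of_ne_bot hg
  refine ⟨c, hc0, ?_⟩
  have := congrArg Subtype.val (LinearMap.mem_ker.1 hc)
  simpa [g, f, Fintype.linearCombination_apply] using this

/-! ### Singular value decompositions -/

theorem toEuclideanLin_sum_vecMulVec {ι : Type*} (F : Finset ι) (s : ι → ℝ)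
    (u : ι → EuclideanSpace ℝ (Fin m)) (v : ι → EuclideanSpace ℝ (Fin k))
    (x : EuclideanSpace ℝ (Fin k)) :
    Matrix.toEuclideanLin (∑ i ∈ F, s i • Matrix.vecMulVec (u i).ofLp (v i).ofLp) x
      = ∑ i ∈ F, (s i * inner ℝ (v i) x) • u i := by
  rw [map_sum, LinearMap.sum_apply]
  refine Finset.sum_congr rfl fun i _ => ?_
  ext a
  simp [Matrix.toLpLin_apply, Matrix.vecMulVec_mulVec, PiLp.inner_apply,
    dotProduct]
  simp only [mul_comm]
  ring

theorem norm_sq_sum_smul_orthonormal {ι E : Type*} [NormedAddCommGroup E] [InnerProductSpace ℝ E]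
    {u : ι → E} (hu : Orthonormal ℝ u) (F : Finset ι) (c : ι → ℝ) :
    ‖∑ i ∈ F, c i • u i‖ ^ 2 = ∑ i ∈ F, c i ^ 2 := by
  rw [← real_inner_self_eq_norm_sq, hu.inner_sum]
  simp [sq]

theorem IsTruncation.rank_le {r : ℕ} {M T : Matrix (Fin m) (Fin k) ℝ} (h : IsTruncation r M T) :
    T.rank ≤ r := by
  obtain ⟨u, v, s, -, -, -, -, -, rfl⟩ := h
  refine (rank_sum_vecMulVec_le _ _ _ _).trans ?_
  have : (Finset.univ.filter fun i : Fin (min m k) => i.val < r).card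
      ≤ (Finset.range r).card :=
    Finset.card_le_card_of_injOn (fun i => i.val) (by intro i; simp)
      (fun a _ b _ hab => Fin.ext hab)
  simpa using this

/-- The Eckart–Young theorem in operator norm. The tail M - T has norm at most the (r+1)-st singular
value `s`. Conversely, by dimension count, `B` kills some nonzero combination z of the first r + 1
right singular vectors, and there ‖(M - B)z‖ = ‖Mz‖ ≥ s‖z‖. The argument works with whichever
decomposition defines `T`, so non-uniqueness is harmless. -/
theorem IsTruncation.norm_sub_le {r : ℕ} {M T : Matrix (Fin m) (Fin k) ℝ}
    (h : IsTruncation r M T) {B : Matrix (Fin m) (Fin k) ℝ} (hB : B.rank ≤ r) :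
    ‖M - T‖ ≤ ‖M - B‖ := by
  obtain ⟨u, v, s, hu, hv, hs, h0, hM, hT⟩ := h
  have hMT : M - T = ∑ i with ¬ i.val < r, s i • Matrix.vecMulVec (u i).ofLp (v i).ofLp := by
    rw [hM, hT, ← Finset.sum_filter_add_sum_filter_not Finset.univ (fun i => i.val < r)]
    simp
  by_cases hr : r < min m k
  swap
  · have : M - T = 0 := by
      rw [hMT]
      refine Finset.sum_eq_zero fun i hi => ?_
      have := i.2
      simp at hi
      omega
    rw [this, norm_zero]
    exact norm_nonneg _
  have hup : ‖M - T‖ ≤ s ⟨r, hr⟩ := by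
    refine l2_opNorm_le_of_forall (h0 _) fun x => ?_
    refine (sq_le_sq₀ (norm_nonneg _) (mul_nonneg (h0 _) (norm_nonneg _))).1 ?_
    rw [hMT, toEuclideanLin_sum_vecMulVec, norm_sq_sum_smul_orthonormal hu, mul_pow]
    calc _ ≤ ∑ i with ¬ i.val < r, s ⟨r, hr⟩ ^ 2 * ‖inner ℝ (v i) x‖ ^ 2 := by
          refine Finset.sum_le_sum fun i hi => ?_
          rw [mul_pow, Real.norm_eq_abs, sq_abs]
          simp at hi
          have := hs (show (⟨r, hr⟩ : Fin (min m k)) ≤ i from hi)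
          have := h0 i
          gcongr
      _ ≤ _ := by
          rw [← Finset.mul_sum]
          gcongr
          exact hv.sum_inner_products_le x
  refine hup.trans ?_
  let e : Fin (r + 1) → Fin (min m k) := Fin.castLE hr
  have he : Function.Injective e := Fin.castLE_injective hr
  obtain ⟨c, hc, hBc⟩ := exists_toEuclideanLin_linearCombination_eq_zero hB (v ∘ e)
  set z : EuclideanSpace ℝ (Fin k) := ∑ i, c i • (v ∘ e) i with hz
  have hzn : ‖z‖ ^ 2 = ∑ i, c i ^ 2 := norm_sq_sum_smul_orthonormal (hv.comp e he) _ _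
  have hzpos : 0 < ‖z‖ := by
    have : 0 < ‖z‖ ^ 2 := by
      rw [hzn]
      obtain ⟨i, hi⟩ := Function.ne_iff.1 hc
      exact Finset.sum_pos' (fun i _ => sq_nonneg _) ⟨i, Finset.mem_univ _, sq_pos_of_ne_zero hi⟩
    exact (norm_nonneg z).lt_of_ne fun h => by simp [← h] at this
  have hzi : ∀ i, inner ℝ (v (e i)) z = c i := fun i => (hv.comp e he).inner_right_fintype c i
  have hlow : (s ⟨r, hr⟩ * ‖z‖) ^ 2 ≤ ‖Matrix.toEuclideanLin (M - B) z‖ ^ 2 := by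
    rw [map_sub, LinearMap.sub_apply, hBc, sub_zero, hM, toEuclideanLin_sum_vecMulVec,
      norm_sq_sum_smul_orthonormal hu, mul_pow, hzn, Finset.mul_sum]
    calc _ ≤ ∑ i, (s (e i) * inner ℝ (v (e i)) z) ^ 2 := by
          refine Finset.sum_le_sum fun i _ => ?_
          rw [hzi, mul_pow]
          have := hs (show e i ≤ ⟨r, hr⟩ from Nat.lt_succ_iff.1 i.2)
          have := h0 ⟨r, hr⟩
          gcongr
      _ = ∑ i ∈ Finset.univ.map ⟨e, he⟩, (s i * inner ℝ (v i) z) ^ 2 := by simp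
      _ ≤ _ := Finset.sum_le_sum_of_subset_of_nonneg (Finset.subset_univ _)
          fun i _ _ => sq_nonneg _
  have := (sq_le_sq₀ (mul_nonneg (h0 _) hzpos.le) (norm_nonneg _)).1 hlow
  exact le_of_mul_le_mul_right (this.trans (norm_toEuclideanLin_le _ _)) hzpos

/-- A matrix splits into a part of rank at most `r` and a remainder controlled by the tail of its
singular values. -/
theorem exists_rank_le_norm_sub_le (A : Matrix (Fin m) (Fin k) ℝ) (r : ℕ) :
    ∃ D : Matrix (Fin m) (Fin k) ℝ, D.rank ≤ r ∧ ‖A - D‖ ≤ sigma (r + 1) A ∧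
      ((A - D) * (A - D)ᵀ).trace ≤ ∑ i ∈ Finset.Icc (r + 1) (min k m), sigma i A ^ 2 := by
  set L := Matrix.toEuclideanLin A with hL
  have hd : Module.finrank ℝ (EuclideanSpace ℝ (Fin k)) = k := by simp
  set b := L.isSymmetric_adjoint_comp_self.eigenvectorBasis hd with hb
  have hAA : ∀ i, Matrix.toEuclideanLin (Aᵀ * A) (b i) = L.singularValues i ^ 2 • b i := fun i => by
    have h := L.isSymmetric_adjoint_comp_self.apply_eigenvectorBasis hd i
    rw [← L.sq_singularValues_fin hd i, ← hb, LinearMap.comp_apply] at h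
    refine Eq.trans ?_ h
    rw [hL, ← Matrix.toEuclideanLin_conjTranspose_eq_adjoint,
      Matrix.conjTranspose_eq_transpose_of_trivial]
    simp [Matrix.toLpLin_apply, Matrix.mulVec_mulVec]
  -- The orthogonal projection onto the top `r` eigenvectors of AᵀA; the witness is A P.
  let P : Matrix (Fin k) (Fin k) ℝ :=
    ∑ i with i.val < r, (1 : ℝ) • Matrix.vecMulVec (b i).ofLp (b i).ofLp
  have hPr : P.rank ≤ r := by
    refine (rank_sum_vecMulVec_le _ _ _ _).trans ?_
    have : (Finset.univ.filter fun i : Fin k => i.val < r).card ≤ (Finset.range r).card :=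
      Finset.card_le_card_of_injOn (fun i => i.val) (by intro i; simp)
        (fun a _ b _ hab => Fin.ext hab)
    simpa using this
  have hP : ∀ x i, inner ℝ (b i) (Matrix.toEuclideanLin P x)
      = if i.val < r then inner ℝ (b i) x else 0 := fun x i => by
    simp only [P]
    rw [toEuclideanLin_sum_vecMulVec, inner_sum]
    simp [inner_smul_right, b.inner_eq_ite]
  have hQ : ∀ x, Matrix.toEuclideanLin (A - A * P) x
      = L (x - Matrix.toEuclideanLin P x) := fun x => by
    simp [L, Matrix.toLpLin_apply, Matrix.mulVec_mulVec, Matrix.mulVec_sub]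
  have hR : ∀ x, ‖Matrix.toEuclideanLin (A - A * P) x‖ ^ 2
      = ∑ i : Fin k, if i.val < r then 0 else L.singularValues i ^ 2 * inner ℝ (b i) x ^ 2 := fun x => by
    rw [hQ, hL, norm_sq_toEuclideanLin, ← b.sum_inner_mul_inner]
    refine Finset.sum_congr rfl fun i _ => ?_
    have : inner ℝ (Matrix.toEuclideanLin (Aᵀ * A) (x - Matrix.toEuclideanLin P x)) (b i)
        = L.singularValues i ^ 2 * inner ℝ (b i) (x - Matrix.toEuclideanLin P x) := by
      rw [← LinearMap.adjoint_inner_right, ← Matrix.toEuclideanLin_conjTranspose_eq_adjoint]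
      simp only [Matrix.conjTranspose_eq_transpose_of_trivial, Matrix.transpose_mul,
        Matrix.transpose_transpose]
      rw [hAA, inner_smul_right, real_inner_comm]
    rw [this, inner_sub_right, hP]
    split_ifs <;> ring
  refine ⟨A * P, (Matrix.rank_mul_le_right _ _).trans hPr, ?_, ?_⟩
  · have hs := L.singularValues_nonneg r
    refine l2_opNorm_le_of_forall hs fun x => ?_
    refine (sq_le_sq₀ (norm_nonneg _) (mul_nonneg hs (norm_nonneg _))).1 ?_
    rw [hR, mul_pow, ← b.sum_sq_inner_right x, Finset.mul_sum]
    refine Finset.sum_le_sum fun i _ => ?_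
    split_ifs with h
    · positivity
    · have := L.singularValues_antitone (not_lt.1 h)
      have := L.singularValues_nonneg i
      change _ ≤ L.singularValues r ^ 2 * _
      gcongr
  · set R := A - A * P with hRdef
    have ht : (R * Rᵀ).trace = ∑ i, ‖Matrix.toEuclideanLin R (b i)‖ ^ 2 := by
      rw [Matrix.trace_mul_comm]
      have h1 : (Rᵀ * R).trace = LinearMap.trace ℝ _ (Matrix.toEuclideanLin (Rᵀ * R)) := by
        rw [Matrix.toEuclideanLin_eq_toLin_orthonormal, Matrix.trace_toLin_eq]
      rw [h1, LinearMap.trace_eq_sum_inner _ b]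
      refine Finset.sum_congr rfl fun i _ => ?_
      rw [norm_sq_toEuclideanLin, real_inner_comm]
    rw [ht]
    have h2 : ∀ i : Fin k, ‖Matrix.toEuclideanLin R (b i)‖ ^ 2
        = if i.val < r then 0 else sigma (i.val + 1) A ^ 2 := fun i => by
      rw [hR, Finset.sum_eq_single i]
      · simp [sigma, L]
      · intro j _ hj
        simp [b.inner_eq_ite, hj]
      · simp
    simp_rw [h2]
    rw [Fin.sum_univ_eq_sum_range (fun i => if i < r then 0 else sigma (i + 1) A ^ 2) k]
    -- The trace runs over all `k` eigenvectors, but singular values past the number of rows vanish.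
    -- The shift `i + 1` passes from zero-based `singularValues` to one-based `sigma`.
    have h3 : ∀ i, m ≤ i → sigma (i + 1) A = 0 := fun i hi => by
      rw [sigma, Nat.add_sub_cancel, LinearMap.singularValues_eq_zero_iff_le_finrank_range]
      refine (Submodule.finrank_le _).trans ?_
      simpa using hi
    rw [← Finset.sum_subset (s₁ := Finset.Ico r (min k m))]
    · have h4 := Finset.sum_Ico_add' (fun i => sigma i A ^ 2) r (min k m) 1
      rw [Finset.Ico_add_one_right_eq_Icc] at h4
      rw [← h4]
      refine (Finset.sum_congr rfl fun i hi => ?_).le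
      rw [if_neg (not_lt.2 (Finset.mem_Ico.1 hi).1)]
    · intro i; simp; omega
    · intro i hi hi'
      simp at hi hi'
      split_ifs with h
      · rfl
      · rw [h3 i (by omega)]; simp

end LinearAlgebra

/-! ### The estimator: noise factor and deterministic excess-risk bound. -/

section Estimator

open scoped Matrix.Norms.L2Operator

variable {m k n dx dy : ℕ}

theorem mul_pinv_self {X : Matrix (Fin m) (Fin k) ℝ} (h : IsUnit (X * Xᵀ).det) :
    X * pinv X = 1 := by
  have h1 := congrArg (fun Z => Z * Xᵀ) (pinv_spec X).1
  simp only [Matrix.mul_assoc (X * pinv X)] at h1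
  have h2 := congrArg (fun Z => Z * (X * Xᵀ)⁻¹) h1
  simpa only [Matrix.mul_nonsing_inv_cancel_right _ _ h, Matrix.mul_nonsing_inv _ h] using h2

theorem transpose_pinv_mul_pinv {X : Matrix (Fin m) (Fin k) ℝ} (h : IsUnit (X * Xᵀ).det) :
    (pinv X)ᵀ * pinv X = (X * Xᵀ)⁻¹ := by
  refine (Matrix.inv_eq_right_inv ?_).symm
  calc X * Xᵀ * ((pinv X)ᵀ * pinv X) = X * ((pinv X * X)ᵀ * pinv X) := by
        simp only [Matrix.transpose_mul, Matrix.mul_assoc]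
    _ = 1 := by
        rw [(pinv_spec X).2.2.2, (pinv_spec X).2.1, mul_pinv_self h]

theorem pinv_eq_of_isUnit_det {X : Matrix (Fin m) (Fin k) ℝ} (h : IsUnit (X * Xᵀ).det) :
    pinv X = Xᵀ * (X * Xᵀ)⁻¹ := by
  rw [← transpose_pinv_mul_pinv h, ← Matrix.mul_assoc, ← Matrix.transpose_mul,
    (pinv_spec X).2.2.2, (pinv_spec X).2.1]

theorem pinv_eq_inv {H : Matrix (Fin k) (Fin k) ℝ} (h : IsUnit H.det) : pinv H = H⁻¹ :=
  (Matrix.inv_eq_right_inv (mul_pinv_self (by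
    rw [Matrix.det_mul, Matrix.det_transpose]; exact h.mul h))).symm

theorem transpose_sqrt (Q : Matrix (Fin k) (Fin k) ℝ) : (CFC.sqrt Q)ᵀ = CFC.sqrt Q := by
  have h : IsSelfAdjoint (CFC.sqrt Q) := (CFC.sqrt_nonneg Q).isSelfAdjoint
  rw [← Matrix.conjTranspose_eq_transpose_of_trivial]
  exact h

theorem sqrt_mul_sqrt {Q : Matrix (Fin k) (Fin k) ℝ} (hQ : Q.PosSemidef) :
    CFC.sqrt Q * CFC.sqrt Q = Q :=
  CFC.sqrt_mul_sqrt_self _ hQ.nonneg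

theorem isUnit_det_sqrt {Q : Matrix (Fin k) (Fin k) ℝ} (hQ : Q.PosSemidef) (h : IsUnit Q.det) :
    IsUnit (CFC.sqrt Q).det := by
  rw [← sqrt_mul_sqrt hQ, Matrix.det_mul] at h
  exact isUnit_of_mul_isUnit_left h

theorem empCov_posSemidef (X : Matrix (Fin dx) (Fin n) ℝ) : (empCov X).PosSemidef := by
  have h := Matrix.posSemidef_self_mul_conjTranspose X
  rw [Matrix.conjTranspose_eq_transpose_of_trivial] at h
  exact h.smul (by positivity)

/-- Q C⁻¹ need not be symmetric, but conjugation by the square root of `C` turns it into a symmetric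
matrix with the same spectrum. -/
theorem lambdaMax_mul_inv {Q C : Matrix (Fin k) (Fin k) ℝ} (hC : C.PosSemidef)
    (hu : IsUnit C.det) :
    lambdaMax (Q * C⁻¹) = lambdaMax ((CFC.sqrt C)⁻¹ * Q * (CFC.sqrt C)⁻¹) := by
  have hH := isUnit_det_sqrt hC hu
  set H := CFC.sqrt C with hHdef
  have hHH : H * H = C := sqrt_mul_sqrt hC
  have e := spectrum.units_conjugate (R := ℝ) (a := H⁻¹ * Q * H⁻¹) (u := H.nonsingInvUnit hH)
  have e2 : (H.nonsingInvUnit hH : Matrix _ _ ℝ) * (H⁻¹ * Q * H⁻¹)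
      * (↑(H.nonsingInvUnit hH)⁻¹ : Matrix _ _ ℝ) = Q * C⁻¹ := by
    rw [← hHH, Matrix.mul_inv_rev]
    change H * (H⁻¹ * Q * H⁻¹) * H⁻¹ = _
    simp only [Matrix.mul_assoc]
    rw [Matrix.mul_nonsing_inv_cancel_left _ _ hH]
  rw [e2] at e
  rw [lambdaMax, lambdaMax, e]

/-- Both sides are ‖Q^{1/2} C^{-1/2}‖². On the right only `C⁻¹` varies with the data, which makes
measurability evident. -/
theorem lambdaMax_mul_inv_eq_norm {Q C : Matrix (Fin k) (Fin k) ℝ} (hQ : Q.PosSemidef)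
    (hC : C.PosSemidef) (hu : IsUnit C.det) :
    lambdaMax (Q * C⁻¹) = ‖CFC.sqrt Q * C⁻¹ * CFC.sqrt Q‖ := by
  have hHt : ((CFC.sqrt C)⁻¹)ᵀ = (CFC.sqrt C)⁻¹ := by
    rw [Matrix.transpose_nonsing_inv, transpose_sqrt]
  have e1 : (CFC.sqrt C)⁻¹ * Q * (CFC.sqrt C)⁻¹
      = (CFC.sqrt Q * (CFC.sqrt C)⁻¹)ᵀ * (CFC.sqrt Q * (CFC.sqrt C)⁻¹) := by
    rw [Matrix.transpose_mul, hHt, transpose_sqrt]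
    nth_rewrite 1 [← sqrt_mul_sqrt hQ]
    simp only [Matrix.mul_assoc]
  have e2 : CFC.sqrt Q * C⁻¹ * CFC.sqrt Q
      = (CFC.sqrt Q * (CFC.sqrt C)⁻¹) * (CFC.sqrt Q * (CFC.sqrt C)⁻¹)ᵀ := by
    rw [Matrix.transpose_mul, hHt, transpose_sqrt]
    nth_rewrite 1 [← sqrt_mul_sqrt hC]
    rw [Matrix.mul_inv_rev]
    simp only [Matrix.mul_assoc]
  rw [lambdaMax_mul_inv hC hu, e1, e2, lambdaMax_transpose_mul_self, l2_opNorm_mul_transpose_self]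

/-- The matrix `X† Ĉ^{1/2}` through which the noise enters the estimator. -/
noncomputable def noiseFactor (X : Matrix (Fin dx) (Fin n) ℝ) : Matrix (Fin n) (Fin dx) ℝ :=
  pinv X * CFC.sqrt (empCov X)

theorem isUnit_det_mul_transpose {X : Matrix (Fin dx) (Fin n) ℝ} (h : IsUnit (empCov X).det) :
    IsUnit (X * Xᵀ).det := by
  rw [empCov, Matrix.det_smul] at h
  exact isUnit_of_mul_isUnit_right h

theorem inv_mul_transpose_eq {X : Matrix (Fin dx) (Fin n) ℝ} (hn : n ≠ 0)
    (h : IsUnit (empCov X).det) : (X * Xᵀ)⁻¹ = (1 / (n : ℝ)) • (empCov X)⁻¹ := by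
  refine Matrix.inv_eq_right_inv ?_
  have : X * Xᵀ = (n : ℝ) • empCov X := by
    rw [empCov, smul_smul, mul_one_div_cancel (by positivity), one_smul]
  rw [this, Matrix.smul_mul, Matrix.mul_smul, smul_smul, mul_one_div_cancel (by positivity),
    one_smul, Matrix.mul_nonsing_inv _ h]

/-- The source of the 1/n rate: (X Xᵀ)⁻¹ = Ĉ⁻¹/n, and the two outer square roots cancel Ĉ⁻¹. -/
theorem noiseFactor_transpose_mul_self {X : Matrix (Fin dx) (Fin n) ℝ} (hn : n ≠ 0)
    (h : IsUnit (empCov X).det) :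
    (noiseFactor X)ᵀ * noiseFactor X = (1 / (n : ℝ)) • (1 : Matrix (Fin dx) (Fin dx) ℝ) := by
  have hX := isUnit_det_mul_transpose h
  have hH := isUnit_det_sqrt (empCov_posSemidef X) h
  have e : (noiseFactor X)ᵀ * noiseFactor X
      = CFC.sqrt (empCov X) * ((pinv X)ᵀ * pinv X) * CFC.sqrt (empCov X) := by
    rw [noiseFactor, Matrix.transpose_mul, transpose_sqrt]
    simp only [Matrix.mul_assoc]
  rw [e, transpose_pinv_mul_pinv hX, inv_mul_transpose_eq hn h, Matrix.mul_smul, Matrix.smul_mul]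
  congr 1
  nth_rewrite 2 [← sqrt_mul_sqrt (empCov_posSemidef X)]
  rw [Matrix.mul_inv_rev, ← Matrix.mul_assoc, Matrix.mul_nonsing_inv _ hH, Matrix.one_mul,
    Matrix.nonsing_inv_mul _ hH]

theorem noiseFactor_mul_transpose_self {X : Matrix (Fin dx) (Fin n) ℝ}
    (h : IsUnit (empCov X).det) :
    noiseFactor X * (noiseFactor X)ᵀ = (1 / (n : ℝ)) • (Xᵀ * (X * Xᵀ)⁻¹ * X) := by
  have hX := isUnit_det_mul_transpose h
  have e : noiseFactor X * (noiseFactor X)ᵀ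
      = pinv X * (CFC.sqrt (empCov X) * CFC.sqrt (empCov X)) * (pinv X)ᵀ := by
    rw [noiseFactor, Matrix.transpose_mul, transpose_sqrt]
    simp only [Matrix.mul_assoc]
  rw [e, sqrt_mul_sqrt (empCov_posSemidef X), empCov, Matrix.mul_smul, Matrix.smul_mul]
  congr 1
  calc pinv X * (X * Xᵀ) * (pinv X)ᵀ = pinv X * X * (pinv X * X)ᵀ := by
        simp only [Matrix.transpose_mul, Matrix.mul_assoc]
    _ = _ := by
        rw [(pinv_spec X).2.2.2, ← Matrix.mul_assoc, (pinv_spec X).2.1, pinv_eq_of_isUnit_det hX]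

/-- Removes the matrix square root: the noise enters through the projection onto the row space of
`X`, a rational expression in the entries and hence measurable. -/
theorem norm_mul_noiseFactor_sq {X : Matrix (Fin dx) (Fin n) ℝ} (h : IsUnit (empCov X).det)
    (E : Matrix (Fin dy) (Fin n) ℝ) :
    ‖E * noiseFactor X‖ ^ 2 = 1 / (n : ℝ) * ‖E * (Xᵀ * (X * Xᵀ)⁻¹ * X) * Eᵀ‖ := by
  have e : E * noiseFactor X * (E * noiseFactor X)ᵀ
      = (1 / (n : ℝ)) • (E * (Xᵀ * (X * Xᵀ)⁻¹ * X) * Eᵀ) := by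
    rw [← Matrix.smul_mul, ← Matrix.mul_smul, ← noiseFactor_mul_transpose_self h]
    simp only [Matrix.transpose_mul, Matrix.mul_assoc]
  rw [← l2_opNorm_mul_transpose_self, e, norm_smul, Real.norm_of_nonneg (by positivity)]

/-- Parallelogram law for the semidefinite form given by `Q`: the difference of the two sides is the
form at A - B. -/
theorem trace_add_conj_le {Q : Matrix (Fin k) (Fin k) ℝ} (hQ : Q.PosSemidef)
    (A B : Matrix (Fin m) (Fin k) ℝ) :
    ((A + B) * Q * (A + B)ᵀ).trace
      ≤ 2 * (A * Q * Aᵀ).trace + 2 * (B * Q * Bᵀ).trace := by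
  have h := (hQ.mul_mul_conjTranspose_same (A - B)).trace_nonneg
  rw [Matrix.conjTranspose_eq_transpose_of_trivial] at h
  simp only [Matrix.transpose_add, Matrix.transpose_sub, Matrix.add_mul, Matrix.mul_add,
    Matrix.sub_mul, Matrix.mul_sub, Matrix.trace_add, Matrix.trace_sub] at h ⊢
  linarith

/-- Triangle inequality through `W`, with `B` itself as competitor in Eckart–Young. -/
theorem IsTruncation.norm_sub_mul_le {r : ℕ} {W T B : Matrix (Fin m) (Fin k) ℝ}
    (hT : IsTruncation r W T) (hB : B.rank ≤ r) : ‖T - B‖ ≤ 2 * ‖W - B‖ := by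
  have h1 : T - B = (W - B) - (W - T) := by abel
  rw [h1]
  linarith [_root_.norm_sub_le (W - B) (W - T), hT.norm_sub_le hB]

/-- The excess risk of a LoRA solution, in terms of a rank-`r` approximation `D` of the optimal
update and of the noise. -/
theorem IsLoRASolution.trace_excess_le {r : ℕ} {A₀ Astar A D : Matrix (Fin dy) (Fin dx) ℝ}
    {X : Matrix (Fin dx) (Fin n) ℝ} {Y : Matrix (Fin dy) (Fin n) ℝ}
    {Q : Matrix (Fin dx) (Fin dx) ℝ} (hA : IsLoRASolution r A₀ X Y A)
    (h : IsUnit (empCov X).det) (hQ : Q.PosSemidef) (hD : D.rank ≤ r) :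
    ((A - Astar) * Q * (A - Astar)ᵀ).trace
      ≤ 2 * lambdaMax Q * ((Astar - A₀ - D) * (Astar - A₀ - D)ᵀ).trace
        + 32 * r * lambdaMax (Q * (empCov X)⁻¹) *
          (‖(Y - Astar * X) * noiseFactor X‖ ^ 2 + ‖Astar - A₀ - D‖ ^ 2 * lambdaMax (empCov X)) := by
  obtain ⟨T, hT, rfl⟩ := hA
  have hC := empCov_posSemidef X
  have hX := isUnit_det_mul_transpose h
  have hH := isUnit_det_sqrt hC h
  set H := CFC.sqrt (empCov X) with hHdef
  have hHt : (H⁻¹)ᵀ = H⁻¹ := by rw [Matrix.transpose_nonsing_inv, transpose_sqrt]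
  set R := Astar - A₀ - D with hR
  set N := (Y - Astar * X) * noiseFactor X with hN
  have hW : fftUpdate A₀ X Y * H = D * H + (R * H + N) := by
    have e : fftUpdate A₀ X Y = Astar - A₀ + (Y - Astar * X) * pinv X := by
      rw [fftUpdate]
      have : Y - A₀ * X = (Astar - A₀) * X + (Y - Astar * X) := by
        rw [Matrix.sub_mul]; abel
      rw [this, Matrix.add_mul, Matrix.mul_assoc, mul_pinv_self hX, Matrix.mul_one]
    rw [e, hN, noiseFactor, hR, ← Matrix.mul_assoc, ← hHdef]
    simp only [Matrix.add_mul, Matrix.sub_mul]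
    abel
  -- Comparing with D H instead of the full Δ⋆ H keeps the rank of the difference at most 2r.
  set K := T - D * H with hK
  have hKn : ‖K‖ ≤ 2 * (‖R‖ * ‖H‖ + ‖N‖) := by
    refine (hT.norm_sub_mul_le ((Matrix.rank_mul_le_left D H).trans hD)).trans ?_
    rw [hW, add_sub_cancel_left]
    gcongr
    exact (norm_add_le _ _).trans (by gcongr; exact Matrix.l2_opNorm_mul _ _)
  have hKr : (K.rank : ℝ) ≤ 2 * r := by
    have : K.rank ≤ 2 * r := by
      rw [hK, sub_eq_add_neg]
      refine (rank_add_le _ _).trans ?_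
      rw [rank_neg, two_mul]
      exact add_le_add hT.rank_le ((Matrix.rank_mul_le_left D H).trans hD)
    exact_mod_cast this
  have hHn : ‖H‖ ^ 2 = lambdaMax (empCov X) := by
    rw [← lambdaMax_transpose_mul_self, transpose_sqrt, sqrt_mul_sqrt hC]
  have hdec : A₀ + T * pinv H - Astar = K * H⁻¹ + -R := by
    rw [pinv_eq_inv hH, hK, hR, Matrix.sub_mul, Matrix.mul_nonsing_inv_cancel_right _ _ hH]
    abel
  have hQs : (H⁻¹ * Q * H⁻¹).PosSemidef := by
    have := hQ.mul_mul_conjTranspose_same H⁻¹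
    rwa [Matrix.conjTranspose_eq_transpose_of_trivial, hHt] at this
  have hlam := lambdaMax_nonneg hQs
  have hK2 : (K * H⁻¹ * Q * (K * H⁻¹)ᵀ).trace
      ≤ lambdaMax (Q * (empCov X)⁻¹) * (2 * r * (8 * (‖N‖ ^ 2 + ‖R‖ ^ 2 * lambdaMax (empCov X)))) := by
    have e : K * H⁻¹ * Q * (K * H⁻¹)ᵀ = K * (H⁻¹ * Q * H⁻¹) * Kᵀ := by
      rw [Matrix.transpose_mul, hHt]
      simp only [Matrix.mul_assoc]
    rw [e, lambdaMax_mul_inv hC h, ← hHdef]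
    refine (trace_conj_le hQs.1 K).trans ?_
    gcongr
    refine (trace_mul_transpose_self_le K).trans ?_
    -- From (2(a + b))² ≤ 8(a² + b²). With the rank 2r and the factor 2 of the parallelogram law
    -- this makes the constant 32r.
    have : ‖K‖ ^ 2 ≤ 8 * (‖N‖ ^ 2 + ‖R‖ ^ 2 * lambdaMax (empCov X)) := by
      rw [← hHn]
      calc ‖K‖ ^ 2 ≤ (2 * (‖R‖ * ‖H‖ + ‖N‖)) ^ 2 := by gcongr
        _ ≤ _ := by nlinarith [sq_nonneg (‖R‖ * ‖H‖ - ‖N‖)]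
    gcongr
  rw [hdec]
  have h1 := trace_add_conj_le hQ (K * H⁻¹) (-R)
  have h2 := trace_conj_le hQ.1 R
  simp only [Matrix.transpose_neg, Matrix.neg_mul, Matrix.mul_neg, neg_neg] at h1
  linarith

end Estimator

/-! ### Nets -/

/-- The unit ball of a `d`-dimensional normed space has a `1/2`-net of cardinality at most `5 ^ d`. -/
theorem exists_half_net (E : Type*) [NormedAddCommGroup E] [NormedSpace ℝ E]
    [FiniteDimensional ℝ E] :
    ∃ N : Finset E, N.card ≤ 5 ^ Module.finrank ℝ E ∧ (∀ u ∈ N, ‖u‖ ≤ 1) ∧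
      ∀ u : E, ‖u‖ ≤ 1 → ∃ u' ∈ N, ‖u - u'‖ ≤ 1 / 2 := by
  classical
  let P : Finset E → Prop := fun N =>
    (∀ u ∈ N, ‖u‖ ≤ 1) ∧ ∀ u ∈ N, ∀ v ∈ N, u ≠ v → 1 / 2 ≤ ‖u - v‖
  have hcard : ∀ N, P N → N.card ≤ 5 ^ Module.finrank ℝ E := fun N hN => by
    -- Doubling turns a 1/2-separated subset of the unit ball into a 1-separated subset of the ball
    -- of radius 2, the normalization of the volume bound.
    have hinj : Function.Injective fun u : E => (2 : ℝ) • u := smul_right_injective E two_ne_zero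
    rw [← Finset.card_image_of_injective N hinj]
    refine Besicovitch.card_le_of_separated _ ?_ ?_
    · intro c hc
      obtain ⟨u, hu, rfl⟩ := Finset.mem_image.1 hc
      have := hN.1 u hu
      simp only [norm_smul, Real.norm_ofNat]
      linarith
    · intro c hc d hd hcd
      obtain ⟨u, hu, rfl⟩ := Finset.mem_image.1 hc
      obtain ⟨v, hv, rfl⟩ := Finset.mem_image.1 hd
      have := hN.2 u hu v hv fun h => hcd (by rw [h])
      simp only [← smul_sub, norm_smul, Real.norm_ofNat]
      linarith
  by_contra! hnet
  -- If no separated set is a net, each can be enlarged by a far point, so separated sets of every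
  -- size exist.
  have hall : ∀ j, ∃ N, P N ∧ N.card = j := fun j => by
    induction j with
    | zero => exact ⟨∅, by simp [P], rfl⟩
    | succ j ih =>
      obtain ⟨N, hN, hj⟩ := ih
      obtain ⟨u, hu, hfar⟩ := hnet N (hcard N hN) hN.1
      have huN : u ∉ N := fun h => by
        have := hfar u h
        norm_num at this
      refine ⟨insert u N, ⟨?_, ?_⟩, by rw [Finset.card_insert_of_notMem huN, hj]⟩
      · intro v hv
        rcases Finset.mem_insert.1 hv with rfl | hv
        · exact hu
        · exact hN.1 v hv
      · intro v hv w hw hvw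
        rcases Finset.mem_insert.1 hv with rfl | hv' <;> rcases Finset.mem_insert.1 hw with rfl | hw'
        · exact absurd rfl hvw
        · exact (hfar w hw').le
        · rw [norm_sub_rev]
          exact (hfar v hv').le
        · exact hN.2 v hv' w hw' hvw
  obtain ⟨N, hN, hj⟩ := hall (5 ^ Module.finrank ℝ E + 1)
  have := hcard N hN
  omega

section NormNet

open scoped Matrix.Norms.L2Operator

/-- Rounding the left vector loses at most half of ‖Aw‖, so ‖Aw‖ ≤ 2b on the net; rounding the right
vector then gives ‖A‖ ≤ 2b + ‖A‖/2. -/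
theorem norm_le_of_half_nets {m k : ℕ} {Nm : Finset (EuclideanSpace ℝ (Fin m))}
    {Nk : Finset (EuclideanSpace ℝ (Fin k))}
    (hm : ∀ u : EuclideanSpace ℝ (Fin m), ‖u‖ ≤ 1 → ∃ u' ∈ Nm, ‖u - u'‖ ≤ 1 / 2)
    (hk : ∀ u : EuclideanSpace ℝ (Fin k), ‖u‖ ≤ 1 → ∃ u' ∈ Nk, ‖u - u'‖ ≤ 1 / 2)
    (A : Matrix (Fin m) (Fin k) ℝ) {b : ℝ} (hb : 0 ≤ b)
    (h : ∀ u ∈ Nm, ∀ w ∈ Nk, |inner ℝ u (Matrix.toEuclideanLin A w)| ≤ b) : ‖A‖ ≤ 4 * b := by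
  have h1 : ∀ w ∈ Nk, ‖Matrix.toEuclideanLin A w‖ ≤ 2 * b := fun w hw => by
    set z := Matrix.toEuclideanLin A w with hz
    rcases eq_or_ne z 0 with h0 | h0
    · rw [h0, norm_zero]; positivity
    have hz0 : 0 < ‖z‖ := norm_pos_iff.2 h0
    obtain ⟨u, hu, hd⟩ := hm (‖z‖⁻¹ • z) (by
      rw [norm_smul, norm_inv, norm_norm, inv_mul_cancel₀ hz0.ne'])
    have e : inner ℝ (‖z‖⁻¹ • z) z = ‖z‖ := by
      rw [real_inner_smul_left, real_inner_self_eq_norm_sq, sq, inv_mul_cancel_left₀ hz0.ne']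
    have e2 : inner ℝ (‖z‖⁻¹ • z) z = inner ℝ (‖z‖⁻¹ • z - u) z + inner ℝ u z := by
      rw [inner_sub_left]; ring
    have h3 : inner ℝ (‖z‖⁻¹ • z - u) z ≤ 1 / 2 * ‖z‖ :=
      (real_inner_le_norm _ _).trans (by gcongr)
    have h4 := (le_abs_self _).trans (h u hu w hw)
    linarith
  have h2 : ‖A‖ ≤ 2 * b + 1 / 2 * ‖A‖ := by
    rw [Matrix.l2_opNorm_def]
    refine ContinuousLinearMap.opNorm_le_of_unit_norm (by positivity) fun x hx => ?_
    rw [← Matrix.l2_opNorm_def]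
    obtain ⟨w, hw, hd⟩ := hk x hx.le
    have e : Matrix.toEuclideanLin A x
        = Matrix.toEuclideanLin A w + Matrix.toEuclideanLin A (x - w) := by
      rw [← map_add]; congr 1; abel
    change ‖Matrix.toEuclideanLin A x‖ ≤ _
    rw [e]
    refine (norm_add_le _ _).trans (add_le_add (h1 w hw) ?_)
    refine (norm_toEuclideanLin_le _ _).trans ?_
    rw [mul_comm]
    gcongr
  linarith

end NormNet

/-! ### Gaussian matrices -/

/-- Replaces integration of Gaussian tails by a moment generating function. For a ≥ t put x = t(a -
t)/s; then a² is t² plus a quadratic in x without constant term, and x ≤ eˣ, x² ≤ 2eˣ. -/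
theorem sq_le_add_exp {s t : ℝ} (hs : 0 < s) (ht : 0 < t) (a : ℝ) :
    a ^ 2 ≤ t ^ 2 + (2 * s + 2 * s ^ 2 / t ^ 2) * Real.exp (-(t ^ 2 / s)) *
      (Real.exp (t / s * a) + Real.exp (-(t / s) * a)) := by
  wlog ha : 0 ≤ a generalizing a
  · have := this (-a) (by linarith)
    rw [neg_sq] at this
    refine this.trans_eq ?_
    rw [show t / s * -a = -(t / s) * a by ring, show -(t / s) * -a = t / s * a by ring]
    ring
  rcases le_total a t with hat | hat
  · have : a ^ 2 ≤ t ^ 2 := by gcongr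
    have : 0 ≤ (2 * s + 2 * s ^ 2 / t ^ 2) * Real.exp (-(t ^ 2 / s)) *
      (Real.exp (t / s * a) + Real.exp (-(t / s) * a)) := by positivity
    linarith
  set x := t / s * (a - t) with hx
  have hx0 : 0 ≤ x := mul_nonneg (by positivity) (by linarith)
  have hax : a = t + s / t * x := by
    rw [hx]; field_simp; ring
  have e : Real.exp (-(t ^ 2 / s)) * Real.exp (t / s * a) = Real.exp x := by
    rw [← Real.exp_add, hx]
    congr 1
    field_simp
    ring
  have h1 : x ≤ Real.exp x := by linarith [Real.add_one_le_exp x]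
  have h2 : x ^ 2 ≤ 2 * Real.exp x := by linarith [Real.quadratic_le_exp_of_nonneg hx0]
  have h3 : a ^ 2 = t ^ 2 + 2 * s * x + s ^ 2 / t ^ 2 * x ^ 2 := by
    rw [hax]; field_simp; ring
  have h4 : 0 ≤ (2 * s + 2 * s ^ 2 / t ^ 2) *
      (Real.exp (-(t ^ 2 / s)) * Real.exp (-(t / s) * a)) := by positivity
  have h5 : 2 * s * x ≤ 2 * s * Real.exp x := by gcongr
  have h6 : s ^ 2 / t ^ 2 * x ^ 2 ≤ s ^ 2 / t ^ 2 * (2 * Real.exp x) := by gcongr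
  calc a ^ 2 ≤ t ^ 2 + (2 * s + 2 * s ^ 2 / t ^ 2) * Real.exp x := by
        rw [h3]
        have : (2 * s + 2 * s ^ 2 / t ^ 2) * Real.exp x
          = 2 * s * Real.exp x + s ^ 2 / t ^ 2 * (2 * Real.exp x) := by ring
        linarith
    _ ≤ _ := by
        rw [← e]
        linarith

section Gaussian

variable {n dx dy : ℕ} {S : Matrix (Fin dy) (Fin dy) ℝ}

theorem map_inner_multivariateGaussian (w : EuclideanSpace ℝ (Fin dy)) :
    ∃ v, (multivariateGaussian 0 S).map (fun e => inner ℝ w e) = gaussianReal 0 v ∧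
      (S.PosSemidef → v = inner ℝ (Matrix.toEuclideanLin S w) w) := by
  have h := IsGaussian.map_eq_gaussianReal (μ := multivariateGaussian 0 S) (innerSL ℝ w)
  have hmean : ∫ x, innerSL ℝ w x ∂(multivariateGaussian 0 S) = 0 := by
    rw [(innerSL ℝ w).integral_comp_id_comm IsGaussian.integrable_id,
      integral_id_multivariateGaussian, map_zero]
  rw [hmean] at h
  refine ⟨_, h, fun hS => ?_⟩
  have hv := covarianceBilin_self (μ := multivariateGaussian 0 S) IsGaussian.memLp_two_id w
  rw [covarianceBilin_multivariateGaussian hS] at hv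
  rw [Real.coe_toNNReal _ (variance_nonneg _ _)]
  refine hv.symm.trans ?_
  simp [Matrix.toLpLin_apply, PiLp.inner_apply, dotProduct, Matrix.mulVec]

theorem integrable_exp_inner_multivariateGaussian (w : EuclideanSpace ℝ (Fin dy)) :
    Integrable (fun e => Real.exp (inner ℝ w e)) (multivariateGaussian 0 S) := by
  obtain ⟨v, hv, -⟩ := map_inner_multivariateGaussian (S := S) w
  have h := integrable_exp_mul_gaussianReal (μ := 0) (v := v) 1
  rw [← hv, integrable_map_measure (by fun_prop) (by fun_prop)] at h
  simpa [Function.comp_def] using h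

theorem integral_exp_inner_multivariateGaussian_le (hS : S.PosSemidef)
    (w : EuclideanSpace ℝ (Fin dy)) :
    ∫ e, Real.exp (inner ℝ w e) ∂(multivariateGaussian 0 S)
      ≤ Real.exp (lambdaMax S * ‖w‖ ^ 2 / 2) := by
  obtain ⟨v, hv, hvS⟩ := map_inner_multivariateGaussian (S := S) w
  have h := mgf_gaussianReal hv 1
  simp only [mgf, one_mul, zero_add, one_pow, mul_one, hvS hS] at h
  rw [h]
  have := inner_toEuclideanLin_le_lambdaMax hS.1 w
  gcongr

open scoped Matrix.Norms.L2Operator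

theorem inner_dataMatrix_mul (V : Matrix (Fin n) (Fin dx) ℝ)
    (u : EuclideanSpace ℝ (Fin dy)) (w : EuclideanSpace ℝ (Fin dx))
    (e : Fin n → EuclideanSpace ℝ (Fin dy)) :
    inner ℝ u (Matrix.toEuclideanLin (dataMatrix e * V) w)
      = ∑ i, inner ℝ ((Matrix.toEuclideanLin V w) i • u) (e i) := by
  have h : Matrix.toEuclideanLin (dataMatrix e * V) w
      = ∑ i, (Matrix.toEuclideanLin V w) i • e i := by
    ext a
    simp only [Matrix.toLpLin_apply, ← Matrix.mulVec_mulVec]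
    rw [WithLp.ofLp_sum, Finset.sum_apply]
    simp [Matrix.mulVec, dotProduct, dataMatrix, mul_comm]
  rw [h, inner_sum]
  simp only [inner_smul_left, inner_smul_right]
  rfl

theorem integrable_exp_inner_dataMatrix_mul (V : Matrix (Fin n) (Fin dx) ℝ)
    (u : EuclideanSpace ℝ (Fin dy)) (w : EuclideanSpace ℝ (Fin dx)) (θ : ℝ) :
    Integrable (fun e : Fin n → EuclideanSpace ℝ (Fin dy) =>
        Real.exp (θ * inner ℝ u (Matrix.toEuclideanLin (dataMatrix e * V) w)))
      (Measure.pi fun _ => multivariateGaussian 0 S) := by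
  have h := Integrable.fintype_prod (μ := fun _ : Fin n => multivariateGaussian 0 S)
    fun i => integrable_exp_inner_multivariateGaussian (S := S)
      (θ • (Matrix.toEuclideanLin V w) i • u)
  convert! h using 2 with e
  rw [← Real.exp_sum, inner_dataMatrix_mul, Finset.mul_sum]
  simp only [real_inner_smul_left]

/-- The bilinear form is a sum over `i` of independent centred Gaussians (Vw)ᵢ⟨u, eᵢ⟩, of total
variance at most λmax(S)‖Vw‖²‖u‖². -/
theorem integral_exp_inner_dataMatrix_mul_le (hS : S.PosSemidef) (V : Matrix (Fin n) (Fin dx) ℝ)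
    {u : EuclideanSpace ℝ (Fin dy)} {w : EuclideanSpace ℝ (Fin dx)} (hu : ‖u‖ ≤ 1) (hw : ‖w‖ ≤ 1)
    (θ : ℝ) :
    ∫ e : Fin n → EuclideanSpace ℝ (Fin dy), Real.exp (θ * inner ℝ u (Matrix.toEuclideanLin (dataMatrix e * V) w))
        ∂(Measure.pi fun _ : Fin n => multivariateGaussian 0 S)
      ≤ Real.exp (θ ^ 2 * (lambdaMax S * ‖V‖ ^ 2) / 2) := by
  have hl := lambdaMax_nonneg hS
  set c := Matrix.toEuclideanLin V w with hc
  have e1 : ∀ e : Fin n → EuclideanSpace ℝ (Fin dy),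
      Real.exp (θ * inner ℝ u (Matrix.toEuclideanLin (dataMatrix e * V) w))
        = ∏ i, Real.exp (inner ℝ (θ • c i • u) (e i)) := fun e => by
    rw [← Real.exp_sum, inner_dataMatrix_mul, Finset.mul_sum]
    simp only [real_inner_smul_left, hc]
  simp_rw [e1]
  rw [integral_fintype_prod_eq_prod (fun i e => Real.exp (inner ℝ (θ • c i • u) e))]
  calc _ ≤ ∏ i, Real.exp (lambdaMax S * ‖θ • c i • u‖ ^ 2 / 2) :=
        Finset.prod_le_prod (fun i _ => integral_nonneg fun _ => (Real.exp_pos _).le)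
          fun i _ => integral_exp_inner_multivariateGaussian_le hS _
    _ = Real.exp (θ ^ 2 * (lambdaMax S * (‖c‖ ^ 2 * ‖u‖ ^ 2)) / 2) := by
        rw [← Real.exp_sum, EuclideanSpace.real_norm_sq_eq, Finset.sum_mul, Finset.mul_sum,
          Finset.mul_sum, Finset.sum_div]
        congr 1
        refine Finset.sum_congr rfl fun i _ => ?_
        rw [norm_smul, norm_smul, mul_pow, mul_pow, Real.norm_eq_abs, Real.norm_eq_abs, sq_abs,
          sq_abs]
        ring
    _ ≤ _ := by
        have h1 : ‖c‖ ≤ ‖V‖ := (norm_toEuclideanLin_le V w).trans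
          (mul_le_of_le_one_right (norm_nonneg _) hw)
        have h2 : ‖c‖ ^ 2 * ‖u‖ ^ 2 ≤ ‖V‖ ^ 2 * 1 ^ 2 := by gcongr
        rw [one_pow, mul_one] at h2
        gcongr

theorem lintegral_norm_dataMatrix_mul_sq_le_of_pos (hS : S.PosSemidef)
    (V : Matrix (Fin n) (Fin dx) ℝ) (hd : 0 < dx) {s : ℝ} (hs : 0 < s)
    (hsV : lambdaMax S * ‖V‖ ^ 2 ≤ s) :
    ∫⁻ e : Fin n → EuclideanSpace ℝ (Fin dy), ENNReal.ofReal (‖dataMatrix e * V‖ ^ 2)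
        ∂(Measure.pi fun _ => multivariateGaussian 0 S)
      ≤ ENNReal.ofReal (288 * max (dx : ℝ) dy * s) := by
  obtain ⟨Nm, hmc, hm1, hm⟩ := exists_half_net (EuclideanSpace ℝ (Fin dy))
  obtain ⟨Nk, hkc, hk1, hk⟩ := exists_half_net (EuclideanSpace ℝ (Fin dx))
  rw [finrank_euclideanSpace_fin] at hmc hkc
  set D : ℝ := dx + dy with hD
  have hD1 : 1 ≤ D := by
    have : (1 : ℝ) ≤ dx := by exact_mod_cast hd
    have : (0 : ℝ) ≤ dy := by positivity
    linarith
  -- Chosen so that exponentials cancel: the product net has at most 5^D ≤ e^{2D} points, the moment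
  -- generating function at t/s is at most e^{t²/(2s)} = e^{2D}, and the prefactor is e^{-t²/s} =
  -- e^{-4D}.
  set t := Real.sqrt (4 * s * D) with ht
  have ht2 : t ^ 2 = 4 * s * D := Real.sq_sqrt (by positivity)
  have ht0 : 0 < t := Real.sqrt_pos.2 (by positivity)
  set K := (2 * s + 2 * s ^ 2 / t ^ 2) * Real.exp (-(t ^ 2 / s)) with hK
  have hK0 : 0 ≤ K := by positivity
  let a := fun (p : EuclideanSpace ℝ (Fin dy) × EuclideanSpace ℝ (Fin dx))
    (e : Fin n → EuclideanSpace ℝ (Fin dy)) =>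
      inner ℝ p.1 (Matrix.toEuclideanLin (dataMatrix e * V) p.2)
  let g := fun p e => Real.exp (t / s * a p e) + Real.exp (-(t / s) * a p e)
  have hg0 : ∀ p e, 0 ≤ g p e := fun p e => by positivity
  let G := fun e => 16 * (t ^ 2 + K * ∑ p ∈ Nm ×ˢ Nk, g p e)
  have hpt : ∀ e, ‖dataMatrix e * V‖ ^ 2 ≤ G e := fun e => by
    have hS0 : 0 ≤ t ^ 2 + K * ∑ p ∈ Nm ×ˢ Nk, g p e :=
      add_nonneg (sq_nonneg _) (mul_nonneg hK0 (Finset.sum_nonneg fun p _ => hg0 p e))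
    have := norm_le_of_half_nets hm hk (dataMatrix e * V)
      (Real.sqrt_nonneg (t ^ 2 + K * ∑ p ∈ Nm ×ˢ Nk, g p e)) fun u hu w hw => by
      refine Real.le_sqrt_of_sq_le ?_
      rw [sq_abs]
      refine (sq_le_add_exp hs ht0 _).trans ?_
      have hle : g (u, w) e ≤ ∑ p ∈ Nm ×ˢ Nk, g p e :=
        Finset.single_le_sum (f := fun p => g p e) (fun p _ => hg0 p e)
          (Finset.mk_mem_product hu hw)
      exact add_le_add le_rfl (mul_le_mul_of_nonneg_left hle hK0)
    calc _ ≤ (4 * Real.sqrt (t ^ 2 + K * ∑ p ∈ Nm ×ˢ Nk, g p e)) ^ 2 := by gcongr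
      _ = G e := by
        rw [mul_pow, Real.sq_sqrt hS0, show (4 : ℝ) ^ 2 = 16 by norm_num]
  set P : Measure (Fin n → EuclideanSpace ℝ (Fin dy)) :=
    Measure.pi fun _ => multivariateGaussian 0 S with hP
  have hgi : ∀ p, Integrable (g p) P := fun p =>
    (integrable_exp_inner_dataMatrix_mul V p.1 p.2 _).add
      (integrable_exp_inner_dataMatrix_mul V p.1 p.2 _)
  have hsum : Integrable (fun e => ∑ p ∈ Nm ×ˢ Nk, g p e) P :=
    integrable_finsetSum _ fun p _ => hgi p
  have hGi : Integrable G P := ((integrable_const _).add (hsum.const_mul K)).const_mul 16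
  have hgint : ∀ p ∈ Nm ×ˢ Nk, ∫ e, g p e ∂P ≤ 2 * Real.exp (2 * D) := fun p hp => by
    have hp' := Finset.mem_product.1 hp
    rw [integral_add (integrable_exp_inner_dataMatrix_mul V p.1 p.2 _)
      (integrable_exp_inner_dataMatrix_mul V p.1 p.2 _), two_mul]
    have hexp : ∀ θ : ℝ, θ ^ 2 = (t / s) ^ 2 →
        Real.exp (θ ^ 2 * (lambdaMax S * ‖V‖ ^ 2) / 2) ≤ Real.exp (2 * D) := fun θ hθ => by
      have : θ ^ 2 * (lambdaMax S * ‖V‖ ^ 2) / 2 ≤ θ ^ 2 * s / 2 := by gcongr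
      refine Real.exp_le_exp.2 (this.trans_eq ?_)
      rw [hθ, div_pow, ht2]
      field_simp
      ring
    exact add_le_add
      ((integral_exp_inner_dataMatrix_mul_le hS V (hm1 _ hp'.1) (hk1 _ hp'.2) _).trans
        (hexp _ rfl))
      ((integral_exp_inner_dataMatrix_mul_le hS V (hm1 _ hp'.1) (hk1 _ hp'.2) _).trans
        (hexp _ (neg_sq _)))
  have hcard : ((Nm ×ˢ Nk).card : ℝ) ≤ Real.exp (2 * D) := by
    have h5 : (5 : ℝ) ≤ Real.exp 2 := by
      have := Real.exp_one_gt_d9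
      have e2 : Real.exp 2 = Real.exp 1 * Real.exp 1 := by rw [← Real.exp_add]; norm_num
      rw [e2]; nlinarith
    have e3 : Real.exp (2 * D) = Real.exp 2 ^ (dy + dx) := by
      rw [← Real.exp_nat_mul, hD]; push_cast; ring_nf
    rw [e3]
    calc ((Nm ×ˢ Nk).card : ℝ) ≤ 5 ^ (dy + dx) := by
          rw [Finset.card_product, pow_add]
          exact_mod_cast Nat.mul_le_mul hmc hkc
      _ ≤ _ := by gcongr
  -- 144 = 16 · (4 + 5): t² = 4sD, and the exponential part is at most 5s ≤ 5sD because D ≥ 1.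
  have hfin : ∫ e, G e ∂P ≤ 144 * D * s := by
    simp only [G]
    rw [integral_const_mul, integral_add (integrable_const _) (hsum.const_mul K),
      integral_const_mul, integral_finsetSum _ fun p _ => hgi p]
    simp only [integral_const, probReal_univ, one_smul]
    have h1 : ∑ p ∈ Nm ×ˢ Nk, ∫ e, g p e ∂P ≤ Real.exp (2 * D) * (2 * Real.exp (2 * D)) := by
      refine (Finset.sum_le_card_nsmul _ _ _ hgint).trans ?_
      rw [nsmul_eq_mul]
      gcongr
    have h2 : K * ∑ p ∈ Nm ×ˢ Nk, ∫ e, g p e ∂P ≤ 2 * (2 * s + s / (2 * D)) := by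
      calc _ ≤ K * (Real.exp (2 * D) * (2 * Real.exp (2 * D))) := by gcongr
        _ = 2 * (2 * s + 2 * s ^ 2 / t ^ 2) *
            Real.exp (-(t ^ 2 / s) + (2 * D + 2 * D)) := by
          rw [hK, Real.exp_add, Real.exp_add]; ring
        _ = _ := by
          have : -(t ^ 2 / s) + (2 * D + 2 * D) = 0 := by rw [ht2]; field_simp; ring
          rw [this, Real.exp_zero, ht2]
          field_simp
          ring
    have h3 : s / (2 * D) ≤ s / 2 := by gcongr; linarith
    rw [ht2]
    nlinarith
  have hDm : D ≤ 2 * max (dx : ℝ) dy := by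
    have := le_max_left (dx : ℝ) dy
    have := le_max_right (dx : ℝ) dy
    linarith
  calc _ ≤ ∫⁻ e, ENNReal.ofReal (G e) ∂P :=
        lintegral_mono fun e => ENNReal.ofReal_le_ofReal (hpt e)
    _ = ENNReal.ofReal (∫ e, G e ∂P) :=
        (ofReal_integral_eq_lintegral_ofReal hGi
          (Filter.Eventually.of_forall fun e => (sq_nonneg _).trans (hpt e))).symm
    _ ≤ _ := by
        refine ENNReal.ofReal_le_ofReal (hfin.trans ?_)
        nlinarith

/-- The expected squared operator norm of a Gaussian matrix with independent columns. -/
theorem lintegral_norm_dataMatrix_mul_sq_le (hS : S.PosSemidef)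
    (V : Matrix (Fin n) (Fin dx) ℝ) (hd : 0 < dx) :
    ∫⁻ e : Fin n → EuclideanSpace ℝ (Fin dy), ENNReal.ofReal (‖dataMatrix e * V‖ ^ 2)
        ∂(Measure.pi fun _ => multivariateGaussian 0 S)
      ≤ ENNReal.ofReal (288 * max (dx : ℝ) dy * (lambdaMax S * ‖V‖ ^ 2)) := by
  have hl := lambdaMax_nonneg hS
  -- Letting `s` decrease to the variance proxy covers the degenerate case where the proxy is zero.
  have hlim : Filter.Tendsto (fun s : ℝ => ENNReal.ofReal (288 * max (dx : ℝ) dy * s))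
      (nhdsWithin (lambdaMax S * ‖V‖ ^ 2) (Set.Ioi (lambdaMax S * ‖V‖ ^ 2)))
      (nhds (ENNReal.ofReal (288 * max (dx : ℝ) dy * (lambdaMax S * ‖V‖ ^ 2)))) :=
    ((ENNReal.continuous_ofReal.comp (continuous_const_mul _)).tendsto _).mono_left nhdsWithin_le_nhds
  refine ge_of_tendsto hlim ?_
  filter_upwards [self_mem_nhdsWithin] with s hs
  exact lintegral_norm_dataMatrix_mul_sq_le_of_pos hS V hd
    ((by positivity : (0 : ℝ) ≤ lambdaMax S * ‖V‖ ^ 2).trans_lt hs) (le_of_lt hs)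

end Gaussian

variable {n dx dy : ℕ}

/-! ### The population risk -/

theorem integrable_mul_apply {μ : Measure (EuclideanSpace ℝ (Fin dx))} (hμ : MemLp id 2 μ)
    (i j : Fin dx) : Integrable (fun x : EuclideanSpace ℝ (Fin dx) => x i * x j) μ := by
  have h : ∀ i : Fin dx, MemLp (fun x : EuclideanSpace ℝ (Fin dx) => x i) 2 μ := fun i =>
    (EuclideanSpace.proj (𝕜 := ℝ) i).comp_memLp' hμ
  exact (h i).integrable_mul (h j)

theorem popCov_posSemidef {μ : Measure (EuclideanSpace ℝ (Fin dx))} (hμ : MemLp id 2 μ) :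
    (popCov μ).PosSemidef := by
  refine Matrix.PosSemidef.of_dotProduct_mulVec_nonneg ?_ fun v => ?_
  · ext i j
    simp [popCov, mul_comm]
  · have e : star v ⬝ᵥ popCov μ *ᵥ v = ∫ x : EuclideanSpace ℝ (Fin dx), (∑ i, v i * x i) ^ 2 ∂μ := by
      simp_rw [sq, Finset.sum_mul_sum]
      rw [integral_finsetSum _ fun i _ => integrable_finsetSum _ fun j _ => by
        simpa only [mul_mul_mul_comm] using (integrable_mul_apply hμ i j).const_mul (v i * v j)]
      simp only [dotProduct, Matrix.mulVec, Finset.mul_sum, star_trivial]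
      refine Finset.sum_congr rfl fun i _ => ?_
      rw [integral_finsetSum _ fun j _ => by
        simpa only [mul_mul_mul_comm] using (integrable_mul_apply hμ i j).const_mul (v i * v j)]
      refine Finset.sum_congr rfl fun j _ => ?_
      simp_rw [mul_mul_mul_comm]
      rw [integral_const_mul, popCov, Matrix.of_apply]
      ring
    rw [e]
    exact integral_nonneg fun _ => sq_nonneg _

theorem integral_norm_sq_toEuclideanLin {μ : Measure (EuclideanSpace ℝ (Fin dx))}
    (hμ : MemLp id 2 μ) (B : Matrix (Fin dy) (Fin dx) ℝ) :
    ∫ x, ‖Matrix.toEuclideanLin B x‖ ^ 2 ∂μ = (B * popCov μ * Bᵀ).trace := by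
  have hint : ∀ a i j, Integrable (fun x : EuclideanSpace ℝ (Fin dx) => B a i * x i * (B a j * x j))
      μ := fun a i j => by
    simpa only [mul_mul_mul_comm] using (integrable_mul_apply hμ i j).const_mul (B a i * B a j)
  have e : ∀ x : EuclideanSpace ℝ (Fin dx), ‖Matrix.toEuclideanLin B x‖ ^ 2
      = ∑ a, ∑ j, ∑ i, B a i * x i * (B a j * x j) := fun x => by
    rw [EuclideanSpace.real_norm_sq_eq]
    refine Finset.sum_congr rfl fun a _ => ?_
    rw [Finset.sum_comm, ← Finset.sum_mul_sum, ← sq]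
    simp [Matrix.toLpLin_apply, Matrix.mulVec, dotProduct]
  simp_rw [e]
  rw [integral_finsetSum _ fun a _ => integrable_finsetSum _ fun j _ =>
    integrable_finsetSum _ fun i _ => hint a i j]
  simp only [Matrix.trace, Matrix.diag, Matrix.mul_apply, Matrix.transpose_apply]
  refine Finset.sum_congr rfl fun a _ => ?_
  rw [integral_finsetSum _ fun j _ => integrable_finsetSum _ fun i _ => hint a i j]
  refine Finset.sum_congr rfl fun j _ => ?_
  rw [integral_finsetSum _ fun i _ => hint a i j, Finset.sum_mul]
  refine Finset.sum_congr rfl fun i _ => ?_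
  simp_rw [mul_mul_mul_comm]
  rw [integral_const_mul, popCov, Matrix.of_apply]
  ring

theorem measurable_toEuclideanLin (A : Matrix (Fin dy) (Fin dx) ℝ) :
    Measurable (Matrix.toEuclideanLin A) :=
  (LinearMap.continuous_of_finiteDimensional _).measurable

/-- Expanding the square, the cross term vanishes by Fubini because the noise has mean zero. -/
theorem risk_sampleLaw {μ : Measure (EuclideanSpace ℝ (Fin dx))} [IsProbabilityMeasure μ]
    (hμ : MemLp id 2 μ) (S : Matrix (Fin dy) (Fin dy) ℝ) (Astar A : Matrix (Fin dy) (Fin dx) ℝ) :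
    risk (sampleLaw μ Astar S) A
      = ENNReal.ofReal (((A - Astar) * popCov μ * (A - Astar)ᵀ).trace)
        + ENNReal.ofReal (∫ e, ‖e‖ ^ 2 ∂(multivariateGaussian 0 S)) := by
  set γ := multivariateGaussian (0 : EuclideanSpace ℝ (Fin dy)) S with hγ
  set B := A - Astar with hB
  have hm : Measurable fun p : EuclideanSpace ℝ (Fin dx) × EuclideanSpace ℝ (Fin dy) =>
      (p.1, Matrix.toEuclideanLin Astar p.1 + p.2) :=
    measurable_fst.prodMk (((measurable_toEuclideanLin Astar).comp measurable_fst).add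
      measurable_snd)
  have hf : Measurable fun p : EuclideanSpace ℝ (Fin dx) × EuclideanSpace ℝ (Fin dy) =>
      ‖Matrix.toEuclideanLin A p.1 - p.2‖ₑ ^ 2 :=
    ((((measurable_toEuclideanLin A).comp measurable_fst).sub measurable_snd).enorm).pow_const 2
  have hγ2 : MemLp id 2 γ := IsGaussian.memLp_two_id
  have hB2 : MemLp (fun x => Matrix.toEuclideanLin B x) 2 μ :=
    (LinearMap.toContinuousLinearMap (Matrix.toEuclideanLin B)).comp_memLp' hμ
  have h1 : MemLp (fun p : EuclideanSpace ℝ (Fin dx) × EuclideanSpace ℝ (Fin dy) =>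
      Matrix.toEuclideanLin B p.1) 2 (μ.prod γ) := hB2.comp_fst γ
  have h2 : MemLp (fun p : EuclideanSpace ℝ (Fin dx) × EuclideanSpace ℝ (Fin dy) => p.2) 2
      (μ.prod γ) := hγ2.comp_snd μ
  have i1 := h1.integrable_norm_pow two_ne_zero
  have i2 := h2.integrable_norm_pow two_ne_zero
  have i3 := (h1.sub h2).integrable_norm_pow two_ne_zero
  simp only [Pi.sub_apply] at i3
  have hexp : ∀ p : EuclideanSpace ℝ (Fin dx) × EuclideanSpace ℝ (Fin dy),
      ‖Matrix.toEuclideanLin B p.1 - p.2‖ ^ 2 = ‖Matrix.toEuclideanLin B p.1‖ ^ 2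
        - 2 * inner ℝ (Matrix.toEuclideanLin B p.1) p.2 + ‖p.2‖ ^ 2 := fun p =>
    norm_sub_sq_real _ _
  -- Integrability of the cross term by polarization from the three squared norms.
  have i4 : Integrable (fun p : EuclideanSpace ℝ (Fin dx) × EuclideanSpace ℝ (Fin dy) =>
      inner ℝ (Matrix.toEuclideanLin B p.1) p.2) (μ.prod γ) := by
    refine (((i1.add i2).sub i3).const_mul (1 / 2)).congr (Filter.Eventually.of_forall fun p => ?_)
    simp only [Pi.add_apply, Pi.sub_apply, hexp]
    ring
  have hcross : ∫ p, inner ℝ (Matrix.toEuclideanLin B p.1) p.2 ∂(μ.prod γ) = 0 := by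
    rw [integral_prod _ i4]
    refine integral_eq_zero_of_ae (Filter.Eventually.of_forall fun x => ?_)
    have := integral_inner (𝕜 := ℝ) (μ := γ) IsGaussian.integrable_id (Matrix.toEuclideanLin B x)
    simp only [id] at this
    refine this.trans ?_
    rw [hγ, integral_id_multivariateGaussian, inner_zero_right]
    rfl
  have hval : ∫ p, ‖Matrix.toEuclideanLin B p.1 - p.2‖ ^ 2 ∂(μ.prod γ)
      = (B * popCov μ * Bᵀ).trace + ∫ e, ‖e‖ ^ 2 ∂γ := by
    simp_rw [hexp]
    have i5 : Integrable (fun p : EuclideanSpace ℝ (Fin dx) × EuclideanSpace ℝ (Fin dy) =>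
        ‖Matrix.toEuclideanLin B p.1‖ ^ 2 - 2 * inner ℝ (Matrix.toEuclideanLin B p.1) p.2)
        (μ.prod γ) := i1.sub (i4.const_mul 2)
    have e1 : ∫ p, ‖Matrix.toEuclideanLin B p.1‖ ^ 2 ∂(μ.prod γ)
        = ∫ x, ‖Matrix.toEuclideanLin B x‖ ^ 2 ∂μ := by
      simpa using integral_fun_fst (μ := μ) (ν := γ) fun x => ‖Matrix.toEuclideanLin B x‖ ^ 2
    have e2 : ∫ p, ‖p.2‖ ^ 2 ∂(μ.prod γ) = ∫ e, ‖e‖ ^ 2 ∂γ := by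
      simpa using integral_fun_snd (μ := μ) (ν := γ) fun e : EuclideanSpace ℝ (Fin dy) => ‖e‖ ^ 2
    rw [integral_add i5 i2, integral_sub i1 (i4.const_mul 2),
      integral_const_mul, hcross, mul_zero, sub_zero, e1, e2,
      integral_norm_sq_toEuclideanLin hμ]
  have htr : 0 ≤ (B * popCov μ * Bᵀ).trace := by
    rw [← integral_norm_sq_toEuclideanLin hμ]
    exact integral_nonneg fun _ => by positivity
  rw [risk, sampleLaw, lintegral_map hf hm, ← ENNReal.ofReal_add htr
    (integral_nonneg fun _ => by positivity), ← hval,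
    ofReal_integral_eq_lintegral_ofReal i3 (Filter.Eventually.of_forall fun _ => by positivity)]
  refine lintegral_congr fun p => ?_
  have : Matrix.toEuclideanLin A p.1 - (Matrix.toEuclideanLin Astar p.1 + p.2)
      = Matrix.toEuclideanLin B p.1 - p.2 := by
    rw [hB, map_sub, LinearMap.sub_apply]; abel
  rw [this, ENNReal.ofReal_pow (norm_nonneg _), ofReal_norm]

/-! ### The joint law of features and noise -/

/-- Subtracting A⋆x undoes the shear in `sampleLaw`, so the pairs become i.i.d. with product law;
regrouping coordinates makes the whole feature array independent of the whole noise array. -/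
theorem map_features_noise {Ω : Type*} [MeasurableSpace Ω] {ν : Measure Ω} [IsProbabilityMeasure ν]
    {μ : Measure (EuclideanSpace ℝ (Fin dx))} [IsProbabilityMeasure μ]
    {S : Matrix (Fin dy) (Fin dy) ℝ} {Astar : Matrix (Fin dy) (Fin dx) ℝ}
    {x : Fin n → Ω → EuclideanSpace ℝ (Fin dx)} {y : Fin n → Ω → EuclideanSpace ℝ (Fin dy)}
    (hind : iIndepFun (fun i ω => (x i ω, y i ω)) ν)
    (hlaw : ∀ i, HasLaw (fun ω => (x i ω, y i ω)) (sampleLaw μ Astar S) ν) :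
    HasLaw (fun ω => ((fun i => x i ω), fun i => y i ω - Matrix.toEuclideanLin Astar (x i ω)))
      ((Measure.pi fun _ : Fin n => μ).prod
        (Measure.pi fun _ : Fin n => multivariateGaussian 0 S)) ν := by
  set γ := multivariateGaussian (0 : EuclideanSpace ℝ (Fin dy)) S with hγ
  have hA := measurable_toEuclideanLin Astar
  let φ : EuclideanSpace ℝ (Fin dx) × EuclideanSpace ℝ (Fin dy) →
      EuclideanSpace ℝ (Fin dx) × EuclideanSpace ℝ (Fin dy) :=
    fun p => (p.1, p.2 - Matrix.toEuclideanLin Astar p.1)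
  have hφ : Measurable φ :=
    measurable_fst.prodMk (measurable_snd.sub (hA.comp measurable_fst))
  have hm : Measurable fun p : EuclideanSpace ℝ (Fin dx) × EuclideanSpace ℝ (Fin dy) =>
      (p.1, Matrix.toEuclideanLin Astar p.1 + p.2) :=
    measurable_fst.prodMk ((hA.comp measurable_fst).add measurable_snd)
  have hmap : (sampleLaw μ Astar S).map φ = μ.prod γ := by
    rw [sampleLaw, Measure.map_map hφ hm]
    convert Measure.map_id using 2
    ext p : 1
    simp [φ]
  have hzae : ∀ i, AEMeasurable (fun ω => φ (x i ω, y i ω)) ν := fun i =>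
    hφ.comp_aemeasurable (hlaw i).aemeasurable
  have hzlaw : ∀ i, ν.map (fun ω => φ (x i ω, y i ω)) = μ.prod γ := fun i => by
    rw [← hmap, ← (hlaw i).map_eq, AEMeasurable.map_map_of_aemeasurable hφ.aemeasurable
      (hlaw i).aemeasurable]
    rfl
  have hz : iIndepFun (fun i ω => φ (x i ω, y i ω)) ν := hind.comp (fun _ => φ) fun _ => hφ
  rw [iIndepFun_iff_map_fun_eq_pi_map hzae] at hz
  simp only [hzlaw] at hz
  have hmp := measurePreserving_arrowProdEquivProdArrow (EuclideanSpace ℝ (Fin dx))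
    (EuclideanSpace ℝ (Fin dy)) (Fin n) (fun _ => μ) (fun _ => γ)
  have hae := aemeasurable_pi_lambda _ hzae
  refine ⟨hmp.measurable.comp_aemeasurable hae, ?_⟩
  rw [← hmp.map_eq, ← hz, AEMeasurable.map_map_of_aemeasurable hmp.measurable.aemeasurable hae]
  rfl

/-! ### Measurability of matrix expressions -/

section Measurability

open scoped Matrix.Norms.L2Operator

variable {α : Type*} [MeasurableSpace α] {m k l : ℕ}

theorem measurable_mul_apply {M : α → Matrix (Fin m) (Fin k) ℝ} {N : α → Matrix (Fin k) (Fin l) ℝ}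
    (hM : ∀ i j, Measurable fun a => M a i j) (hN : ∀ i j, Measurable fun a => N a i j)
    (i : Fin m) (j : Fin l) : Measurable fun a => (M a * N a) i j := by
  simp only [Matrix.mul_apply]
  exact Finset.measurable_fun_sum _ fun c _ => (hM i c).mul (hN c j)

theorem measurable_inv_apply {M : α → Matrix (Fin k) (Fin k) ℝ}
    (hM : ∀ i j, Measurable fun a => M a i j) (i j : Fin k) :
    Measurable fun a => (M a)⁻¹ i j := by
  have hM' : Measurable (fun a i j => M a i j) :=
    measurable_pi_lambda _ fun i => measurable_pi_lambda _ fun j => hM i j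
  have hof : Continuous (fun A : Fin k → Fin k → ℝ => Matrix.of A) := continuous_id
  have hdet : Measurable (fun A : Fin k → Fin k → ℝ => (Matrix.of A).det) :=
    hof.matrix_det.measurable
  have hadj : Measurable (fun A : Fin k → Fin k → ℝ => (Matrix.of A).adjugate i j) :=
    (hof.matrix_adjugate.matrix_elem i j).measurable
  simp only [Matrix.inv_def, Ring.inverse_eq_inv', Matrix.smul_apply, smul_eq_mul]
  exact (hdet.comp hM').inv.mul (hadj.comp hM')

theorem measurable_l2_opNorm {M : α → Matrix (Fin m) (Fin k) ℝ}
    (hM : ∀ i j, Measurable fun a => M a i j) : Measurable fun a => ‖M a‖ := by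
  have hM' : Measurable (fun a i j => M a i j) :=
    measurable_pi_lambda _ fun i => measurable_pi_lambda _ fun j => hM i j
  have hn : Continuous (fun A : Fin m → Fin k → ℝ => ‖Matrix.of A‖) :=
    continuous_norm (E := Matrix (Fin m) (Fin k) ℝ)
  exact hn.measurable.comp hM'

theorem measurable_dataMatrix {z : α → Fin n → EuclideanSpace ℝ (Fin k)} (hz : Measurable z)
    (i : Fin k) (j : Fin n) : Measurable fun a => dataMatrix (z a) i j :=
  (EuclideanSpace.proj (𝕜 := ℝ) i).continuous.measurable.comp (measurable_pi_iff.1 hz j)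

theorem measurable_norm_conj_inv_empCov (B : Matrix (Fin dx) (Fin dx) ℝ) :
    Measurable fun x : Fin n → EuclideanSpace ℝ (Fin dx) =>
      ‖B * (empCov (dataMatrix x))⁻¹ * B‖ := by
  have hX : ∀ i j, Measurable fun x : Fin n → EuclideanSpace ℝ (Fin dx) => dataMatrix x i j :=
    measurable_dataMatrix measurable_id
  have hXt : ∀ i j, Measurable fun x : Fin n → EuclideanSpace ℝ (Fin dx) =>
    (dataMatrix x)ᵀ i j := fun i j => hX j i
  have h1 : ∀ i j, Measurable fun x : Fin n → EuclideanSpace ℝ (Fin dx) =>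
      empCov (dataMatrix x) i j := fun i j =>
    (measurable_mul_apply hX hXt i j).const_mul (1 / (n : ℝ))
  have h2 : ∀ i j, Measurable fun _ : Fin n → EuclideanSpace ℝ (Fin dx) => B i j :=
    fun i j => measurable_const
  exact measurable_l2_opNorm (measurable_mul_apply (measurable_mul_apply h2
    (measurable_inv_apply h1)) h2)

theorem measurable_norm_conj_projection :
    Measurable fun p : (Fin n → EuclideanSpace ℝ (Fin dx)) ×
        (Fin n → EuclideanSpace ℝ (Fin dy)) =>
      1 / (n : ℝ) * ‖dataMatrix p.2 * ((dataMatrix p.1)ᵀ *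
        (dataMatrix p.1 * (dataMatrix p.1)ᵀ)⁻¹ * dataMatrix p.1) * (dataMatrix p.2)ᵀ‖ := by
  have hX : ∀ i j, Measurable fun p : (Fin n → EuclideanSpace ℝ (Fin dx)) ×
      (Fin n → EuclideanSpace ℝ (Fin dy)) => dataMatrix p.1 i j := fun i j =>
    measurable_dataMatrix measurable_fst i j
  have hE : ∀ i j, Measurable fun p : (Fin n → EuclideanSpace ℝ (Fin dx)) ×
      (Fin n → EuclideanSpace ℝ (Fin dy)) => dataMatrix p.2 i j := fun i j =>
    measurable_dataMatrix measurable_snd i j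
  have hXt : ∀ i j, Measurable fun p : (Fin n → EuclideanSpace ℝ (Fin dx)) ×
      (Fin n → EuclideanSpace ℝ (Fin dy)) => (dataMatrix p.1)ᵀ i j := fun i j => hX j i
  have hEt : ∀ i j, Measurable fun p : (Fin n → EuclideanSpace ℝ (Fin dx)) ×
      (Fin n → EuclideanSpace ℝ (Fin dy)) => (dataMatrix p.2)ᵀ i j := fun i j => hE j i
  have h1 := measurable_inv_apply (measurable_mul_apply hX hXt)
  have h2 := measurable_mul_apply (measurable_mul_apply hXt h1) hX
  have h3 := measurable_mul_apply (measurable_mul_apply hE h2) hEt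
  exact (measurable_l2_opNorm h3).const_mul _

/-- Tonelli in place of conditional expectation. The weight `f a` stays in the hypothesis so that
the inner integral need only be controlled where `f` is nonzero. -/
theorem lintegral_mul_le_of_hasLaw_prod {Ω β : Type*} [MeasurableSpace Ω] [MeasurableSpace β]
    {ν : Measure Ω} {P : Measure α} {P' : Measure β} [SFinite P] [IsProbabilityMeasure P']
    {x : Ω → α} {e : Ω → β} (hlaw : HasLaw (fun ω => (x ω, e ω)) (P.prod P') ν)
    {f : α → ℝ≥0∞} {g : α × β → ℝ≥0∞} (hf : Measurable f) (hg : Measurable g) {c : ℝ≥0∞}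
    (h : ∀ a, f a * ∫⁻ b, g (a, b) ∂P' ≤ f a * c) :
    AEMeasurable (fun ω => f (x ω) * g (x ω, e ω)) ν ∧
      ∫⁻ ω, f (x ω) * g (x ω, e ω) ∂ν ≤ (∫⁻ ω, f (x ω) ∂ν) * c := by
  have hf' : Measurable fun p : α × β => f p.1 := hf.comp measurable_fst
  have hF : Measurable fun p : α × β => f p.1 * g p := hf'.mul hg
  refine ⟨hF.comp_aemeasurable hlaw.aemeasurable, ?_⟩
  have e1 := lintegral_map' (f := fun p : α × β => f p.1 * g p) hF.aemeasurable hlaw.aemeasurable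
  have e2 := lintegral_map' (f := fun p : α × β => f p.1) hf'.aemeasurable hlaw.aemeasurable
  rw [hlaw.map_eq, lintegral_prod _ hF.aemeasurable] at e1
  rw [hlaw.map_eq, lintegral_prod _ hf'.aemeasurable] at e2
  rw [← e1, ← e2]
  simp only [lintegral_const, measure_univ, mul_one]
  rw [← lintegral_mul_const _ hf]
  refine lintegral_mono fun a => ?_
  dsimp only
  have hga : Measurable fun b => g (a, b) := hg.comp measurable_prodMk_left
  rw [lintegral_const_mul _ hga]
  exact h a

theorem norm_noiseFactor_sq_le {X : Matrix (Fin dx) (Fin n) ℝ} (hn : n ≠ 0)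
    (h : IsUnit (empCov X).det) : ‖noiseFactor X‖ ^ 2 ≤ 1 / n := by
  rw [← l2_opNorm_transpose_mul_self, noiseFactor_transpose_mul_self hn h, norm_smul,
    Real.norm_of_nonneg (by positivity)]
  refine mul_le_of_le_one_right (by positivity) ?_
  exact l2_opNorm_le_of_forall zero_le_one fun v => by simp

/-- Conditionally on the features, the noise contributes at most a multiple of
`max dx dy * lambdaMax S / n`. -/
theorem lintegral_noise_le {Ω : Type*} [MeasurableSpace Ω] {ν : Measure Ω} [IsProbabilityMeasure ν]
    {μ : Measure (EuclideanSpace ℝ (Fin dx))} [IsProbabilityMeasure μ]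
    {S : Matrix (Fin dy) (Fin dy) ℝ} (hS : S.PosSemidef) (hn : n ≠ 0) (hd : 0 < dx)
    {Q : Matrix (Fin dx) (Fin dx) ℝ} (hQ : Q.PosSemidef)
    {x : Ω → Fin n → EuclideanSpace ℝ (Fin dx)} {e : Ω → Fin n → EuclideanSpace ℝ (Fin dy)}
    (hlaw : HasLaw (fun ω => (x ω, e ω)) ((Measure.pi fun _ : Fin n => μ).prod
        (Measure.pi fun _ : Fin n => multivariateGaussian 0 S)) ν)
    (hinv : ∀ᵐ ω ∂ν, IsUnit (empCov (dataMatrix (x ω))).det) :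
    AEMeasurable (fun ω => ENNReal.ofReal (lambdaMax (Q * (empCov (dataMatrix (x ω)))⁻¹) *
        ‖dataMatrix (e ω) * noiseFactor (dataMatrix (x ω))‖ ^ 2)) ν ∧
      ∫⁻ ω, ENNReal.ofReal (lambdaMax (Q * (empCov (dataMatrix (x ω)))⁻¹) *
        ‖dataMatrix (e ω) * noiseFactor (dataMatrix (x ω))‖ ^ 2) ∂ν
      ≤ ENNReal.ofReal (288 * max (dx : ℝ) dy * (lambdaMax S * (1 / n))) *
        ∫⁻ ω, ENNReal.ofReal (lambdaMax (Q * (empCov (dataMatrix (x ω)))⁻¹)) ∂ν := by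
  set γ := multivariateGaussian (0 : EuclideanSpace ℝ (Fin dy)) S with hγ
  have hfe : (fun ω => ENNReal.ofReal (lambdaMax (Q * (empCov (dataMatrix (x ω)))⁻¹)))
      =ᵐ[ν] fun ω => ENNReal.ofReal
        ‖CFC.sqrt Q * (empCov (dataMatrix (x ω)))⁻¹ * CFC.sqrt Q‖ := by
    filter_upwards [hinv] with ω hω
    rw [lambdaMax_mul_inv_eq_norm hQ (empCov_posSemidef _) hω]
  have hge : (fun ω => ENNReal.ofReal (lambdaMax (Q * (empCov (dataMatrix (x ω)))⁻¹) *
      ‖dataMatrix (e ω) * noiseFactor (dataMatrix (x ω))‖ ^ 2)) =ᵐ[ν] fun ω =>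
        ENNReal.ofReal ‖CFC.sqrt Q * (empCov (dataMatrix (x ω)))⁻¹ * CFC.sqrt Q‖ *
        ENNReal.ofReal (1 / (n : ℝ) * ‖dataMatrix (e ω) * ((dataMatrix (x ω))ᵀ *
          (dataMatrix (x ω) * (dataMatrix (x ω))ᵀ)⁻¹ * dataMatrix (x ω)) *
          (dataMatrix (e ω))ᵀ‖) := by
    filter_upwards [hinv] with ω hω
    rw [lambdaMax_mul_inv_eq_norm hQ (empCov_posSemidef _) hω, norm_mul_noiseFactor_sq hω,
      ENNReal.ofReal_mul (norm_nonneg _)]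
  rw [lintegral_congr_ae hfe, lintegral_congr_ae hge, aemeasurable_congr hge, mul_comm]
  refine lintegral_mul_le_of_hasLaw_prod hlaw
    (f := fun x => ENNReal.ofReal ‖CFC.sqrt Q * (empCov (dataMatrix x))⁻¹ * CFC.sqrt Q‖)
    (g := fun p => ENNReal.ofReal (1 / (n : ℝ) * ‖dataMatrix p.2 * ((dataMatrix p.1)ᵀ *
        (dataMatrix p.1 * (dataMatrix p.1)ᵀ)⁻¹ * dataMatrix p.1) * (dataMatrix p.2)ᵀ‖))
    (measurable_norm_conj_inv_empCov _).ennreal_ofReal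
    measurable_norm_conj_projection.ennreal_ofReal fun x => ?_
  by_cases hx : IsUnit (empCov (dataMatrix x)).det
  · refine mul_le_mul_right ?_ _
    simp only [← norm_mul_noiseFactor_sq hx]
    refine (lintegral_norm_dataMatrix_mul_sq_le hS _ hd).trans (ENNReal.ofReal_le_ofReal ?_)
    have := lambdaMax_nonneg hS
    have := norm_noiseFactor_sq_le hn hx
    gcongr
  -- For singular Ĉ the matrix inverse is zero by convention, so the weight vanishes.
  · rw [Matrix.nonsing_inv_apply_not_isUnit _ hx, Matrix.mul_zero, Matrix.zero_mul, norm_zero]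
    simp

end Measurability

theorem dataMatrix_sub_mul {n dx dy : ℕ} (A : Matrix (Fin dy) (Fin dx) ℝ)
    (x : Fin n → EuclideanSpace ℝ (Fin dx)) (y : Fin n → EuclideanSpace ℝ (Fin dy)) :
    dataMatrix y - A * dataMatrix x = dataMatrix fun i => y i - Matrix.toEuclideanLin A (x i) := by
  ext a i
  simp [dataMatrix, Matrix.mul_apply, Matrix.toLpLin_apply, Matrix.mulVec, dotProduct]

/-! ### Pointwise excess-risk bound in `[0, ∞]`. -/

section ExcessRisk

open scoped Matrix.Norms.L2Operator

/-- A pointwise form of `IsLoRASolution.trace_excess_le` in terms of the singular values of the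
optimal update, with values in `[0, ∞]`. -/
theorem IsLoRASolution.ofReal_trace_excess_le {n dx dy r : ℕ}
    {A₀ Astar A : Matrix (Fin dy) (Fin dx) ℝ} {X : Matrix (Fin dx) (Fin n) ℝ}
    {Y : Matrix (Fin dy) (Fin n) ℝ} {Q : Matrix (Fin dx) (Fin dx) ℝ}
    (hA : IsLoRASolution r A₀ X Y A) (h : IsUnit (empCov X).det) (hQ : Q.PosSemidef) :
    ENNReal.ofReal ((A - Astar) * Q * (A - Astar)ᵀ).trace
      ≤ ENNReal.ofReal (2 * (lambdaMax Q *
          ∑ i ∈ Finset.Icc (r + 1) (min dx dy), sigma i (Astar - A₀) ^ 2))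
        + ENNReal.ofReal (32 * r) * ENNReal.ofReal (lambdaMax (Q * (empCov X)⁻¹) *
          ‖(Y - Astar * X) * noiseFactor X‖ ^ 2)
        + ENNReal.ofReal (32 * (r * sigma (r + 1) (Astar - A₀) ^ 2)) *
          ENNReal.ofReal (lambdaMax (empCov X) * lambdaMax (Q * (empCov X)⁻¹)) := by
  obtain ⟨D, hD, hn, ht⟩ := exists_rank_le_norm_sub_le (Astar - A₀) r
  have hl : 0 ≤ lambdaMax (Q * (empCov X)⁻¹) := by
    rw [lambdaMax_mul_inv_eq_norm hQ (empCov_posSemidef X) h]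
    exact norm_nonneg _
  have hlQ := lambdaMax_nonneg hQ
  have hlC := lambdaMax_nonneg (empCov_posSemidef X)
  rw [← ENNReal.ofReal_mul (by positivity), ← ENNReal.ofReal_mul (by positivity),
    ← ENNReal.ofReal_add (by positivity) (by positivity),
    ← ENNReal.ofReal_add (by positivity) (by positivity)]
  refine ENNReal.ofReal_le_ofReal ((hA.trace_excess_le h hQ hD).trans ?_)
  have h1 : 2 * lambdaMax Q * ((Astar - A₀ - D) * (Astar - A₀ - D)ᵀ).trace
      ≤ 2 * lambdaMax Q * ∑ i ∈ Finset.Icc (r + 1) (min dx dy), sigma i (Astar - A₀) ^ 2 := by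
    gcongr
  have h2 : 32 * r * lambdaMax (Q * (empCov X)⁻¹) *
        (‖Astar - A₀ - D‖ ^ 2 * lambdaMax (empCov X))
      ≤ 32 * r * lambdaMax (Q * (empCov X)⁻¹) *
        (sigma (r + 1) (Astar - A₀) ^ 2 * lambdaMax (empCov X)) := by
    gcongr
  linarith

end ExcessRisk

end LoRARegression

theorem mainTheorem1 :
    ∃ C : ℝ, 0 < C ∧
      ∀ (n dx dy r : ℕ), dx ≤ n → r < dx →
      -- feature distribution with finite second moment and covariance of full rank
      ∀ (μ : Measure (EuclideanSpace ℝ (Fin dx))) [IsProbabilityMeasure μ],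
        MemLp id 2 μ →
        (LoRARegression.popCov μ).rank = dx →
      -- noise covariance, ground truth and pre-trained model
      ∀ (S : Matrix (Fin dy) (Fin dy) ℝ), S.PosSemidef →
      ∀ (Astar A₀ : Matrix (Fin dy) (Fin dx) ℝ),
      -- i.i.d. training set
      ∀ {Ω : Type*} [MeasurableSpace Ω] (ν : Measure Ω) [IsProbabilityMeasure ν]
        (x : Fin n → Ω → EuclideanSpace ℝ (Fin dx))
        (y : Fin n → Ω → EuclideanSpace ℝ (Fin dy)),
        iIndepFun (fun i ω => (x i ω, y i ω)) ν →
        (∀ i, HasLaw (fun ω => (x i ω, y i ω)) (LoRARegression.sampleLaw μ Astar S) ν) →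
      -- the empirical covariance is invertible almost surely
        (∀ᵐ ω ∂ν,
          IsUnit (LoRARegression.empCov (LoRARegression.dataMatrix fun i => x i ω)).det) →
      -- the LoRA estimator
      ∀ (Ahat : Ω → Matrix (Fin dy) (Fin dx) ℝ),
        (∀ᵐ ω ∂ν, LoRARegression.IsLoRASolution r A₀
          (LoRARegression.dataMatrix fun i => x i ω)
          (LoRARegression.dataMatrix fun i => y i ω) (Ahat ω)) →
        LoRARegression.risk (LoRARegression.sampleLaw μ Astar S) Astar ≠ ∞ ∧
        (∫⁻ ω, LoRARegression.risk (LoRARegression.sampleLaw μ Astar S) (Ahat ω) ∂ν)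
            - LoRARegression.risk (LoRARegression.sampleLaw μ Astar S) Astar
          ≤ ENNReal.ofReal C *
            (ENNReal.ofReal (r * max (dx : ℝ) dy / n * LoRARegression.lambdaMax S) *
                ∫⁻ ω, ENNReal.ofReal (LoRARegression.lambdaMax (LoRARegression.popCov μ *
                  (LoRARegression.empCov (LoRARegression.dataMatrix fun i => x i ω))⁻¹)) ∂ν
              + ENNReal.ofReal (LoRARegression.lambdaMax (LoRARegression.popCov μ) *
                  (r * LoRARegression.sigma (r + 1) (Astar - A₀) ^ 2
                    + ∑ i ∈ Finset.Icc (r + 1) (min dx dy),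
                        LoRARegression.sigma i (Astar - A₀) ^ 2))
              + ENNReal.ofReal (r * LoRARegression.sigma (r + 1) (Astar - A₀) ^ 2) *
                ∫⁻ ω, ENNReal.ofReal
                  (LoRARegression.lambdaMax
                      (LoRARegression.empCov (LoRARegression.dataMatrix fun i => x i ω)) *
                    LoRARegression.lambdaMax (LoRARegression.popCov μ *
                      (LoRARegression.empCov (LoRARegression.dataMatrix fun i => x i ω))⁻¹))
                  ∂ν) := by
  -- 9216 = 32 · 288: the deterministic constant times the Gaussian one.
  refine ⟨9216, by norm_num, ?_⟩
  intro n dx dy r hn hr μ _ hμ _ S hS Astar A₀ Ω _ ν _ x y hind hlaw hinv Ahat hAhat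
  have hdx : 0 < dx := by omega
  have hn0 : n ≠ 0 := by omega
  have hQ := LoRARegression.popCov_posSemidef hμ
  have hlS := LoRARegression.lambdaMax_nonneg hS
  have hlQ := LoRARegression.lambdaMax_nonneg hQ
  have hrisk := LoRARegression.risk_sampleLaw hμ S Astar
  have hstar := hrisk Astar
  rw [sub_self, Matrix.zero_mul, Matrix.zero_mul, Matrix.trace_zero, ENNReal.ofReal_zero,
    zero_add] at hstar
  refine ⟨by rw [hstar]; exact ENNReal.ofReal_ne_top, ?_⟩
  obtain ⟨hmeas, hnoise⟩ := LoRARegression.lintegral_noise_le (ν := ν) hS hn0 hdx hQ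
    (LoRARegression.map_features_noise hind hlaw) hinv
  set Z : ℝ := LoRARegression.sigma (r + 1) (Astar - A₀) ^ 2 with hZ
  set W : ℝ := ∑ i ∈ Finset.Icc (r + 1) (min dx dy), LoRARegression.sigma i (Astar - A₀) ^ 2
    with hW
  have hZ0 : 0 ≤ Z := sq_nonneg _
  have hW0 : 0 ≤ W := Finset.sum_nonneg fun _ _ => sq_nonneg _
  open scoped Matrix.Norms.L2Operator in
  set f : Ω → ℝ≥0∞ := fun ω => ENNReal.ofReal
    (LoRARegression.lambdaMax (LoRARegression.popCov μ *
      (LoRARegression.empCov (LoRARegression.dataMatrix fun i => x i ω))⁻¹) *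
    ‖(LoRARegression.dataMatrix fun i => y i ω - Matrix.toEuclideanLin Astar (x i ω)) *
      LoRARegression.noiseFactor (LoRARegression.dataMatrix fun i => x i ω)‖ ^ 2) with hf
  set g : Ω → ℝ≥0∞ := fun ω => ENNReal.ofReal
    (LoRARegression.lambdaMax (LoRARegression.empCov (LoRARegression.dataMatrix fun i => x i ω)) *
      LoRARegression.lambdaMax (LoRARegression.popCov μ *
        (LoRARegression.empCov (LoRARegression.dataMatrix fun i => x i ω))⁻¹)) with hg
  set ρ := LoRARegression.risk (LoRARegression.sampleLaw μ Astar S) Astar with hρ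
  have hpt : ∀ᵐ ω ∂ν, LoRARegression.risk (LoRARegression.sampleLaw μ Astar S) (Ahat ω)
      ≤ ρ + ENNReal.ofReal (2 * (LoRARegression.lambdaMax (LoRARegression.popCov μ) * W))
        + ENNReal.ofReal (32 * r) * f ω + ENNReal.ofReal (32 * (r * Z)) * g ω := by
    filter_upwards [hinv, hAhat] with ω h1 h2
    rw [hrisk, ← hstar, add_comm, add_assoc, add_assoc, ← add_assoc (ENNReal.ofReal (2 * _))]
    have h3 := h2.ofReal_trace_excess_le (Astar := Astar) h1 hQ
    rw [LoRARegression.dataMatrix_sub_mul] at h3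
    gcongr
  rw [tsub_le_iff_left]
  refine (lintegral_mono_ae hpt).trans ?_
  -- Splitting the integral needs measurability of the noise term `f` only, so neither the estimator
  -- nor `g` has to be measurable.
  rw [lintegral_add_left' (by fun_prop), lintegral_add_left' (by fun_prop),
    lintegral_const, measure_univ, mul_one, lintegral_const_mul' _ _ ENNReal.ofReal_ne_top,
    lintegral_const_mul' _ _ ENNReal.ofReal_ne_top, add_assoc, add_assoc, mul_add, mul_add,
    add_assoc, ← mul_assoc (ENNReal.ofReal 9216), ← mul_assoc (ENNReal.ofReal 9216),
    ← ENNReal.ofReal_mul (by norm_num), ← ENNReal.ofReal_mul (by norm_num),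
    ← ENNReal.ofReal_mul (by norm_num), add_left_comm (ENNReal.ofReal (9216 * _) * _)]
  refine add_le_add le_rfl (add_le_add (ENNReal.ofReal_le_ofReal ?_) (add_le_add ?_ ?_))
  -- Only the tail sum `W` is used here; the r σ²_{r+1} part of the second term is slack.
  · have h1 : 0 ≤ LoRARegression.lambdaMax (LoRARegression.popCov μ) * (r * Z) := by positivity
    have h2 : 0 ≤ LoRARegression.lambdaMax (LoRARegression.popCov μ) * W := by positivity
    linarith
  · refine (mul_le_mul_right hnoise _).trans ?_
    rw [← mul_assoc, ← ENNReal.ofReal_mul (by positivity)]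
    refine mul_le_mul_left (ENNReal.ofReal_le_ofReal (le_of_eq ?_)) _
    ring
  · refine mul_le_mul_left (ENNReal.ofReal_le_ofReal ?_) _
    have : 0 ≤ r * Z := by positivity
    linarith
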